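/- **Setting.** Let $Z$ be a real Hilbert space and let $A$ generate an exponentially stable analytic semigroup $e^{At}$ on $Z$, with compact resolvent. For $s\ge 0$ let $Z^{s}=\operatorname{ran}(-A)^{-s}$ with $\|\varphi\|_s=\|(-A)^s\varphi\|$, and let $Z^{-s}$ be the completion of $Z$ in the norm $\|(-A)^{-s}\varphi\|$. Let $s_b,s_c,s_d\in[0,1)$ with $s_c+s_b<1$ and $s_c+s_d<1$; let $B_{\rm in}\in Z^{-s_b}$, $B_{\rm d}\in Z^{-s_d}$ (one-dimensional input and disturbance), let $C:Z^{s_c}\to\mathbb R$ be bounded linear, and suppose $G=C(-A)^{-1}B_{\rm in}\ne0$. Let $f:Z\to Z$ satisfy $\|f(\varphi_1)-f(\varphi_2)\|\le\epsilon\|\varphi_1-\varphi_2\|_{s_1}$ for some $0<s_1<1$, $\epsilon>0$. Put $B=B_{\rm in}G^{-1}$, $I_0=I+BCA^{-1}$ and, for $0<\beta<1$, $A_\beta=A-\frac{1-\beta}{\beta}BC$, regarded as an operator in $Z^{-s}$, $s=\max\{s_b,s_d\}$, with domain $Z^{1-s}$. Suppose that $\beta$ is such that the semigroup $e^{A_\beta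 t}$ on $Z^{-s}$ generated by $A_\beta$ is exponentially stable. **Iteration.** Let $r,d:[0,\infty)\to\mathbb R$ be continuous, $\bar z_0\in Z$, $n\ge1$, and let $\bar z^0,\dots,\bar z^n\in C([0,\infty);Z^{s_1}\cap Z^{s_c})$ be mild solutions (variation of parameters) of $$\tfrac{d}{dt}\bar z^0=A_\beta\bar z^0+I_0\big(f(\bar z^0)+B_{\rm d}d\big)+\tfrac1\beta B r,\quad \bar z^0(0)=\bar z_0,\qquad e_0=r-C\bar z^0,$$ $$\tfrac{d}{dt}\bar z^j=A_\beta\bar z^j+I_0F_j+\tfrac1\beta B e_{j-1},\quad \bar z^j(0)=0,\qquad e_j=e_{j-1}-C\bar z^j\qquad(1\le j\le n),$$ where $F_j=f(\bar z_j)-f(\bar z_{j-1})$ and $\bar z_j=\sum_{i=0}^j\bar z^i$. **Constants.** Let $K(t)=-\frac1\beta CA_\beta^{-1}e^{A_\beta t}B$ and $$D=\int_0^\infty|K(t)|\,dt,\quad D_H=\int_0^\infty\|Ce^{A_\beta t}I_0\|_{\mathcal L(Z,\mathbb R)}\,dt,$$ and, for $0<T\le\infty$, $$D_B(T)=\int_0^T\big\|\tfrac1\beta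 e^{A_\beta t}B\big\|_{s_1}dt,\quad D_{A_\beta}(T)=\int_0^T\|e^{A_\beta t}I_0\|_{\mathcal L(Z,Z^{s_1})}\,dt,\quad \mathcal D(T)=D_H\,\frac{\epsilon D_B(T)}{1-\epsilon D_{A_\beta}(T)}$$ (values in $[0,\infty]$; $\mathcal D(T)$ is used only when $\epsilon D_{A_\beta}(T)<1$; products in $[0,\infty]$ use $0\cdot\infty=0$). Write $\|e\|_{(0,t)}=\sup_{0<\tau<t}|e(\tau)|$ and $\|e\|_{1,(0,t)}=\max\{\|e\|_{(0,t)},\|e'\|_{(0,t)}\}$. **Proposition.** $D$ and $D_H$ are finite, and: i) Let $t>0$, let $e_{n-1}$ be $C^1$ on $(0,t)$ and $\epsilon D_{A_\beta}(t)<1$. Then, with the transient $G_n(\tau)=K(\tau)e_{n-1}(0)$, $$\|e_n-G_n\|_{(0,t)}\le\big(D+\mathcal D(t)\big)\,\|e_{n-1}\|_{1,(0,t)} .$$ If the initial state satisfies $C\bar z_0=r(0)$, then $$\|e_n\|_{(0,t)}\le\big(D+\mathcal D(t)\big)\,\|e_{n-1}\|_{1,(0,t)} .$$ ii) If $e_{n-1}$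 is $C^1$ on $(0,\infty)$, $D_B(\infty)<\infty$ and $\epsilon D_{A_\beta}(\infty)<1$, then (for every admissible $\bar z_0$) $$\limsup_{t\to\infty}|e_n(t)|\le\big(D+\mathcal D(\infty)\big)\limsup_{t\to\infty}\max\{|e_{n-1}(t)|,|e_{n-1}'(t)|\}.$$ -/

import Mathlib

open MeasureTheory Set Filter Topology
open scoped ENNReal

noncomputable section

namespace GeomReg

/-! ### Strongly continuous semigroups and their generators -/

/-- A strongly continuous semigroup `(T t)_{t ≥ 0}` of bounded operators on a real Banach space.
The values at negative times carry no information. -/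
structure C0Semigroup (E : Type*) [NormedAddCommGroup E] [NormedSpace ℝ E] where
  op : ℝ → E →L[ℝ] E
  op_zero : op 0 = ContinuousLinearMap.id ℝ E
  op_add : ∀ s t : ℝ, 0 ≤ s → 0 ≤ t → op (s + t) = (op s).comp (op t)
  continuousOn : ∀ x : E, ContinuousOn (fun t => op t x) (Ici 0)

namespace C0Semigroup

variable {E : Type*} [NormedAddCommGroup E] [NormedSpace ℝ E]

/-- The graph of the infinitesimal generator: `(x, y)` belongs to it iff
`y = lim_{h ↓ 0} (T h x - x) / h`. -/
def generatorGraph (T : C0Semigroup E) : Set (E × E) :=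
  {p | Tendsto (fun h : ℝ => h⁻¹ • (T.op h p.1 - p.1)) (𝓝[>] 0) (𝓝 p.2)}

/-- `‖T t‖ ≤ M e^{-ω t}` for some `M ≥ 1`, `ω > 0` and all `t ≥ 0`. -/
def ExpStable (T : C0Semigroup E) : Prop :=
  ∃ M ω : ℝ, 1 ≤ M ∧ 0 < ω ∧ ∀ t : ℝ, 0 ≤ t → ‖T.op t‖ ≤ M * Real.exp (-ω * t)

/-- Analyticity of an (exponentially stable) semigroup with generator `A`, over the reals:
`T t` maps `E` into `D(A)` for `t > 0`, and `‖A T(t)‖ ≤ M / t`. -/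
def IsAnalytic (T : C0Semigroup E) : Prop :=
  ∃ M : ℝ, ∀ t : ℝ, 0 < t → ∀ x : E, ∃ y : E,
    (T.op t x, y) ∈ T.generatorGraph ∧ ‖y‖ ≤ M / t * ‖x‖

/-- The generator `A` has a compact resolvent: for some real `lam`, `R = (lam - A)⁻¹` exists as an
everywhere defined bounded operator and is compact. -/
def HasCompactResolvent (T : C0Semigroup E) : Prop :=
  ∃ (lam : ℝ) (R : E →L[ℝ] E), IsCompactOperator R ∧
    ∀ x y : E, y = R x ↔ (y, lam • y - x) ∈ T.generatorGraph

end C0Semigroup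

/-! ### Fractional powers and the scale of spaces generated by `A` -/

section Scale

variable {Z : Type*} [NormedAddCommGroup Z] [InnerProductSpace ℝ Z] [CompleteSpace Z]

/-- The negative fractional power `(-A)^{-s}`, `s ≥ 0`, of the generator `A` of `T`:
`(-A)^{-s} = Γ(s)⁻¹ ∫_0^∞ t^{s-1} e^{At} dt` for `s > 0`, and the identity for `s = 0`. -/
def negPow (T : C0Semigroup Z) (s : ℝ) : Z →L[ℝ] Z :=
  if s = 0 then ContinuousLinearMap.id ℝ Z
  else (Real.Gamma s)⁻¹ • ∫ t in Ioi (0 : ℝ), t ^ (s - 1) • T.op t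

/-- The space `Z^s = ran (-A)^{-s}`, `s ≥ 0`, as a subspace of `Z`. -/
def posSpace (T : C0Semigroup Z) (s : ℝ) : Submodule ℝ Z :=
  LinearMap.range (negPow T s : Z →ₗ[ℝ] Z)

/-- The norm `‖φ‖_s = ‖(-A)^s φ‖` for `φ ∈ Z^s`, with value `∞` off `Z^s`. -/
def posNorm (T : C0Semigroup Z) (s : ℝ) (φ : Z) : ℝ≥0∞ :=
  ⨅ (v : Z) (_ : negPow T s v = φ), ‖v‖ₑ

/-- `z : [0, ∞) → Z^s` is continuous for the norm of `Z^s`. -/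
def ContinuousInto (T : C0Semigroup Z) (s : ℝ) (z : ℝ → Z) : Prop :=
  ∃ v : ℝ → Z, ContinuousOn v (Ici 0) ∧ ∀ t : ℝ, 0 ≤ t → z t = negPow T s (v t)

/-- A copy of `Z`, to be given the norm `‖φ‖_{-s} = ‖(-A)^{-s} φ‖`. -/
@[nolint unusedArguments]
def PreNeg (_T : C0Semigroup Z) (_s : ℝ) : Type _ := Z

instance (T : C0Semigroup Z) (s : ℝ) : AddCommGroup (PreNeg T s) :=
  inferInstanceAs (AddCommGroup Z)

instance (T : C0Semigroup Z) (s : ℝ) : Module ℝ (PreNeg T s) :=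
  inferInstanceAs (Module ℝ Z)

/-- The identity map from `Z` to its copy. -/
def toPreNeg (T : C0Semigroup Z) (s : ℝ) : Z ≃ₗ[ℝ] PreNeg T s := LinearEquiv.refl ℝ Z

/-- `(-A)^{-s}` as a linear map out of the copy of `Z`. -/
def preNegMap (T : C0Semigroup Z) (s : ℝ) : PreNeg T s →ₗ[ℝ] Z :=
  (negPow T s : Z →ₗ[ℝ] Z) ∘ₗ ((toPreNeg T s).symm : PreNeg T s →ₗ[ℝ] Z)

instance (T : C0Semigroup Z) (s : ℝ) : SeminormedAddCommGroup (PreNeg T s) :=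
  SeminormedAddCommGroup.induced (PreNeg T s) Z (preNegMap T s)

instance (T : C0Semigroup Z) (s : ℝ) : NormedSpace ℝ (PreNeg T s) :=
  NormedSpace.induced ℝ (PreNeg T s) Z (preNegMap T s)

/-- The space `Z^{-s}`, `s ≥ 0`: the completion of `Z` in the norm `‖φ‖_{-s} = ‖(-A)^{-s} φ‖`. -/
abbrev NegSpace (T : C0Semigroup Z) (s : ℝ) : Type _ := UniformSpace.Completion (PreNeg T s)

/-- The inclusion `Z ⊆ Z^{-s}`. -/
def incl (T : C0Semigroup Z) (s : ℝ) (φ : Z) : NegSpace T s :=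
  (toPreNeg T s φ : UniformSpace.Completion (PreNeg T s))

/-- The inclusion `Z^{-s} ⊆ Z^{-s'}` for `s ≤ s'`: the continuous extension of the identity. -/
def inclNeg (T : C0Semigroup Z) (s s' : ℝ) : NegSpace T s → NegSpace T s' :=
  UniformSpace.Completion.map (fun φ : PreNeg T s => toPreNeg T s' ((toPreNeg T s).symm φ))

/-- The norm `‖x‖_σ`, `σ ≥ 0`, of an element `x` of `Z^{-s}`; it is `∞` if `x ∉ Z^σ`. -/
def posNormNeg (T : C0Semigroup Z) (s σ : ℝ) (x : NegSpace T s) : ℝ≥0∞ :=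
  ⨅ (φ : Z) (_ : incl T s φ = x), posNorm T σ φ

/-- The graph of the extension `A : Z^{1-s} → Z^{-s}`, as an unbounded operator in `Z^{-s}`:
the closure in `Z^{-s} × Z^{-s}` of the graph of `A : D(A) → Z`. -/
def extGraph (T : C0Semigroup Z) (s : ℝ) : Set (NegSpace T s × NegSpace T s) :=
  closure (Prod.map (incl T s) (incl T s) '' T.generatorGraph)

end Scale

open Classical in
/-- The inverse `L⁻¹ x` of an (injective) operator `L` given by its graph; `0` if `x ∉ ran L`. -/
def graphInv {X : Type*} [Zero X] (L : Set (X × X)) (x : X) : X :=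
  if h : ∃ y : X, (y, x) ∈ L then h.choose else 0

/-! ### The control system -/

/-- The data of the SISO control system `z' = A z + f(z) + B_in u + B_d d`, `y = C z`, where `A`
is the generator of `T`, together with the regularization parameter `β`.
As `U = D = Y = ℝ`, the operators `B_in : ℝ → Z^{-s_b}` and `B_d : ℝ → Z^{-s_d}` are
multiplications by the vectors `bIn` and `bD`. -/
structure Plant (Z : Type*) [NormedAddCommGroup Z] [InnerProductSpace ℝ Z] [CompleteSpace Z] where
  T : C0Semigroup Z
  sb : ℝ
  sd : ℝ
  sc : ℝ
  s1 : ℝ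
  bIn : NegSpace T sb
  bD : NegSpace T sd
  C : posSpace T sc →ₗ[ℝ] ℝ
  f : Z → Z
  ε : ℝ
  β : ℝ

namespace Plant

variable {Z : Type*} [NormedAddCommGroup Z] [InnerProductSpace ℝ Z] [CompleteSpace Z]

/-- The space `Z^{-s}`, `s = max (s_b, s_d)`, which contains `Z`, `Z^{-s_b}` and `Z^{-s_d}`. -/
abbrev X (P : Plant Z) : Type _ := NegSpace P.T (max P.sb P.sd)

/-- The inclusion `Z ⊆ X`. -/
def ι (P : Plant Z) (φ : Z) : P.X := incl P.T (max P.sb P.sd) φ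

/-- `B_in` as an element of `X`. -/
def bInX (P : Plant Z) : P.X := inclNeg P.T P.sb (max P.sb P.sd) P.bIn

/-- `B_d` as an element of `X`. -/
def bDX (P : Plant Z) : P.X := inclNeg P.T P.sd (max P.sb P.sd) P.bD

open Classical in
/-- `C x` for an element `x` of `X` that lies in `Z^{s_c}` (and `0` for all other `x`). -/
def out (P : Plant Z) (x : P.X) : ℝ :=
  if h : ∃ φ : posSpace P.T P.sc, P.ι (φ : Z) = x then P.C h.choose else 0

/-- `A⁻¹ : X → Z^{1-s}`. -/
def Ainv (P : Plant Z) (x : P.X) : P.X := graphInv (extGraph P.T (max P.sb P.sd)) x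

/-- The transfer function at zero, `G = C (-A)⁻¹ B_in`. -/
def gain (P : Plant Z) : ℝ := P.out (-P.Ainv P.bInX)

/-- `B = B_in G⁻¹`. -/
def B (P : Plant Z) : P.X := P.gain⁻¹ • P.bInX

/-- `ζ = (1 - β) / β`. -/
def ζ (P : Plant Z) : ℝ := (1 - P.β) / P.β

/-- The graph of `A_β = A - ζ B C : Z^{1-s} → Z^{-s}`, as an unbounded operator in `X`. -/
def AβGraph (P : Plant Z) : Set (P.X × P.X) :=
  {p | ∃ y : P.X, (p.1, y) ∈ extGraph P.T (max P.sb P.sd) ∧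
    p.2 = y - (P.ζ * P.out p.1) • P.B}

/-- `A_β⁻¹ : X → Z^{1-s}`. -/
def Aβinv (P : Plant Z) (x : P.X) : P.X := graphInv P.AβGraph x

/-- `I_0 = I + B C A⁻¹`. -/
def I0 (P : Plant Z) (x : P.X) : P.X := x + P.out (P.Ainv x) • P.B

/-- The assumptions on the control system. -/
structure Assumptions (P : Plant Z) : Prop where
  stable : P.T.ExpStable
  analytic : P.T.IsAnalytic
  compactResolvent : P.T.HasCompactResolvent
  sb_nonneg : 0 ≤ P.sb
  sd_nonneg : 0 ≤ P.sd
  sc_nonneg : 0 ≤ P.sc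
  sb_lt : P.sb < 1
  sd_lt : P.sd < 1
  sc_lt : P.sc < 1
  scb : P.sc + P.sb < 1
  scd : P.sc + P.sd < 1
  /-- `C` is bounded for the norm of `Z^{s_c}`. -/
  C_bounded : ∃ M : ℝ, ∀ v : Z,
    |P.C ⟨negPow P.T P.sc v, LinearMap.mem_range.2 ⟨v, rfl⟩⟩| ≤ M * ‖v‖
  gain_ne : P.gain ≠ 0
  s1_pos : 0 < P.s1
  s1_lt : P.s1 < 1
  ε_pos : 0 < P.ε
  f_lipschitz : ∀ φ₁ φ₂ : Z,
    ‖P.f φ₁ - P.f φ₂‖ₑ ≤ ENNReal.ofReal P.ε * posNorm P.T P.s1 (φ₁ - φ₂)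
  β_pos : 0 < P.β
  β_lt : P.β < 1

/-! ### The iteration -/

/-- `z_n = ∑_{j=0}^n z^j`. -/
def partialSum (z : ℕ → ℝ → Z) (n : ℕ) (t : ℝ) : Z := ∑ j ∈ Finset.range (n + 1), z j t

/-- The errors `e_0 = r - C z^0`, `e_j = e_{j-1} - C z^j`. -/
def err (P : Plant Z) (r : ℝ → ℝ) (z : ℕ → ℝ → Z) : ℕ → ℝ → ℝ
  | 0, t => r t - P.out (P.ι (z 0 t))
  | j + 1, t => P.err r z j t - P.out (P.ι (z (j + 1) t))

/-- `F_j = f(z_j) - f(z_{j-1})` for `j ≥ 1`. -/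
def Fterm (P : Plant Z) (z : ℕ → ℝ → Z) (j : ℕ) (t : ℝ) : Z :=
  P.f (partialSum z j t) - P.f (partialSum z (j - 1) t)

/-- `z : [0, ∞) → Z` is a mild solution of `z' = A_β z + g`, `z(0) = z₀`, which is continuous with
values in `Z^{s_1}` and in `Z^{s_c}`; here `S t = e^{A_β t}`. -/
structure IsMildSolution (P : Plant Z) (S : C0Semigroup P.X) (z₀ : Z) (g : ℝ → P.X)
    (z : ℝ → Z) : Prop where
  cont_s1 : ContinuousInto P.T P.s1 z
  cont_sc : ContinuousInto P.T P.sc z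
  formula : ∀ t : ℝ, 0 ≤ t →
    P.ι (z t) = S.op t (P.ι z₀) + ∫ τ in (0 : ℝ)..t, S.op (t - τ) (g τ)

/-- `z^0, …, z^n` are produced by the iterative scheme for the reference signal `r`, the
disturbance `d` and the initial state `z₀`:
`(z^0)' = A_β z^0 + I_0 (f(z^0) + B_d d) + β⁻¹ B r`, `z^0(0) = z₀`, and, for `1 ≤ j ≤ n`,
`(z^j)' = A_β z^j + I_0 F_j + β⁻¹ B e_{j-1}`, `z^j(0) = 0`. -/
structure IsIteration (P : Plant Z) (S : C0Semigroup P.X) (r d : ℝ → ℝ) (z₀ : Z) (n : ℕ)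
    (z : ℕ → ℝ → Z) : Prop where
  zero : P.IsMildSolution S z₀
    (fun τ => P.I0 (P.ι (P.f (z 0 τ)) + d τ • P.bDX) + (P.β⁻¹ * r τ) • P.B) (z 0)
  succ : ∀ j : ℕ, 1 ≤ j → j ≤ n → P.IsMildSolution S 0
    (fun τ => P.I0 (P.ι (P.Fterm z j τ)) + (P.β⁻¹ * P.err r z (j - 1) τ) • P.B) (z j)

/-! ### The kernels and the constants; throughout, `S t = e^{A_β t}` -/

/-- `K(t) = -β⁻¹ C A_β⁻¹ e^{A_β t} B`. -/
def K (P : Plant Z) (S : C0Semigroup P.X) (t : ℝ) : ℝ :=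
  -(P.β⁻¹ * P.out (P.Aβinv (S.op t P.B)))

/-- `D = ∫_0^∞ ‖K(t)‖ dt`. -/
def D (P : Plant Z) (S : C0Semigroup P.X) : ℝ≥0∞ :=
  ∫⁻ t in Ioi (0 : ℝ), ‖P.K S t‖ₑ

/-- `D_H = ∫_0^∞ ‖C e^{A_β t} I_0‖ dt`, with the norm of bounded functionals on `Z`. -/
def DH (P : Plant Z) (S : C0Semigroup P.X) : ℝ≥0∞ :=
  ∫⁻ t in Ioi (0 : ℝ), ⨆ (φ : Z) (_ : ‖φ‖ ≤ 1), ‖P.out (S.op t (P.I0 (P.ι φ)))‖ₑ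

/-- `D_B = ∫_J ‖β⁻¹ e^{A_β t} B‖ dt`, with the norm of `Z^{s_1}`; `J` is `(0,t)` or `(0,∞)`. -/
def DB (P : Plant Z) (S : C0Semigroup P.X) (J : Set ℝ) : ℝ≥0∞ :=
  ∫⁻ t in J, posNormNeg P.T (max P.sb P.sd) P.s1 (P.β⁻¹ • S.op t P.B)

/-- `D_{A_β} = ∫_J ‖e^{A_β t} I_0‖ dt`, with the norm of bounded operators from `Z` to `Z^{s_1}`;
`J` is `(0,t)` or `(0,∞)`. -/
def DA (P : Plant Z) (S : C0Semigroup P.X) (J : Set ℝ) : ℝ≥0∞ :=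
  ∫⁻ t in J, ⨆ (φ : Z) (_ : ‖φ‖ ≤ 1),
    posNormNeg P.T (max P.sb P.sd) P.s1 (S.op t (P.I0 (P.ι φ)))

/-- `𝒟 = D_H (D_B ε / (1 - ε D_{A_β}))`, meaningful when `ε D_{A_β} < 1`. -/
def DD (P : Plant Z) (S : C0Semigroup P.X) (J : Set ℝ) : ℝ≥0∞ :=
  P.DH S * (P.DB S J * ENNReal.ofReal P.ε / (1 - ENNReal.ofReal P.ε * P.DA S J))

end Plant

/-! ### Norms of scalar signals -/

/-- `‖e‖_{(0,t)} = sup_{0<τ<t} |e(τ)|`. -/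
def supNorm (t : ℝ) (e : ℝ → ℝ) : ℝ≥0∞ := ⨆ τ ∈ Ioo 0 t, ‖e τ‖ₑ

/-- `‖e‖_{1,(0,t)} = max (sup_{0<τ<t} |e(τ)|, sup_{0<τ<t} |e'(τ)|)`. -/
def supNormOne (t : ℝ) (e : ℝ → ℝ) : ℝ≥0∞ := max (supNorm t e) (supNorm t (deriv e))

end GeomReg

end

/-!
Both the state space `Z^{-s}` and the spaces `Z^σ` are copies of `Z`, through fractional powers of
`-A`, so the regulator can be studied on `Z` itself. There `A_β` is a rank-one perturbation of `A`
(Sherman–Morrison), and the smoothing `‖(-A)^α e^{At}‖ ≤ M t^{-α}` passes to `e^{A_β t}` through the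
variation of constants formula, which makes `C e^{A_β t}` integrable although `C` is unbounded.

As `K' = -β⁻¹ C e^{A_β t} B` and `K 0 = 1`, integrating the output of one step by parts expresses
`e_n` as a transient plus the convolution of `K` with `e_{n-1}'` minus that of `C e^{A_β t} I₀` with
`F_n`. As `‖F_n‖ ≤ ε ‖z^n‖_{s₁}`, a small gain argument bounds `F_n` by `ε D_B / (1 - ε D_{A_β})`
times `e_{n-1}`. The asymptotic bound follows in the same way, with limits superior in place of
suprema.
-/

noncomputable section

namespace GeomReg

section ImageNorm

variable {H X : Type*} [NormedAddCommGroup H] [InnerProductSpace ℝ H]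
  [NormedAddCommGroup X] [NormedSpace ℝ X]

/-- The norm of the range of `J` as a quotient of `H`, with value `∞` off the range. The norms of
`Z^σ`, both on `Z` and on `Z^{-s}`, are of this form. -/
def imageNorm (J : H →L[ℝ] X) (x : X) : ℝ≥0∞ := ⨅ (v : H) (_ : J v = x), ‖v‖ₑ

lemma imageNorm_apply_le (J : H →L[ℝ] X) (v : H) : imageNorm J (J v) ≤ ‖v‖ₑ :=
  iInf₂_le (f := fun (w : H) (_ : J w = J v) => ‖w‖ₑ) v rfl

@[simp]
lemma imageNorm_zero (J : H →L[ℝ] X) : imageNorm J 0 = 0 := by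
  simpa using imageNorm_apply_le J 0

variable [CompleteSpace H]

lemma exists_enorm_eq_imageNorm {J : H →L[ℝ] X} {x : X} (h : imageNorm J x ≠ ∞) :
    ∃ v, J v = x ∧ ‖v‖ₑ = imageNorm J x := by
  have hne : (J ⁻¹' {x}).Nonempty := by
    by_contra! hempty
    exact h (iInf₂_eq_top.2 fun v hv => absurd (show v ∈ J ⁻¹' {x} from hv) (by simp [hempty]))
  have hclosed : IsClosed (J ⁻¹' {x}) := isClosed_singleton.preimage J.continuous
  obtain ⟨v, hv, hmin⟩ := exists_norm_eq_iInf_of_complete_convex hne hclosed.isComplete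
    ((convex_singleton x).linear_preimage (J : H →ₗ[ℝ] X)) 0
  refine ⟨v, hv, le_antisymm (le_iInf₂ fun w hw => ?_) (hv ▸ imageNorm_apply_le J v)⟩
  have hle : ‖v‖ ≤ ‖w‖ := by
    have := ciInf_le (f := fun w : J ⁻¹' {x} => ‖0 - (w : H)‖)
      ⟨0, forall_mem_range.2 fun _ => norm_nonneg _⟩ ⟨w, hw⟩
    rwa [← hmin, zero_sub, zero_sub, norm_neg, norm_neg] at this
  exact enorm_le_iff_norm_le.2 hle

lemma imageNorm_le_ofReal_iff {J : H →L[ℝ] X} {x : X} {M : ℝ} (hM : 0 ≤ M) :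
    imageNorm J x ≤ ENNReal.ofReal M ↔ ∃ v, J v = x ∧ ‖v‖ ≤ M := by
  constructor
  · intro h
    obtain ⟨v, hv, hnorm⟩ := exists_enorm_eq_imageNorm (h.trans_lt ENNReal.ofReal_lt_top).ne
    refine ⟨v, hv, ?_⟩
    rwa [← hnorm, ← ofReal_norm, ENNReal.ofReal_le_ofReal_iff hM] at h
  · rintro ⟨v, rfl, hv⟩
    refine (imageNorm_apply_le J v).trans ?_
    rw [← ofReal_norm]
    exact ENNReal.ofReal_le_ofReal hv

/-- The functional `l ∘ J ↦ l x` is bounded by `M`; by Hahn–Banach and Riesz it is the evaluation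
at some `v` with `‖v‖ ≤ M`, and `J v = x` because functionals separate points. -/
lemma exists_preimage_norm_le_of_forall_dual {J : H →L[ℝ] X} {x : X} {M : ℝ} (hM : 0 ≤ M)
    (h : ∀ l : StrongDual ℝ X, l x ≤ M * ‖l.comp J‖) : ∃ v, J v = x ∧ ‖v‖ ≤ M := by
  have habs (l : StrongDual ℝ X) : |l x| ≤ M * ‖l.comp J‖ :=
    abs_le'.2 ⟨h l, by simpa [ContinuousLinearMap.neg_comp] using h (-l)⟩
  let adj : StrongDual ℝ X →ₗ[ℝ] H :=
    (InnerProductSpace.toDual ℝ H).symm.toLinearMap ∘ₗ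
      ((ContinuousLinearMap.compL ℝ H X ℝ).flip J : StrongDual ℝ X →ₗ[ℝ] StrongDual ℝ H)
  have hadj (l : StrongDual ℝ X) (v : H) : inner ℝ (adj l) v = l (J v) :=
    InnerProductSpace.toDual_symm_apply (y := l.comp J)
  have hadj_norm (l : StrongDual ℝ X) : ‖adj l‖ = ‖l.comp J‖ :=
    (InnerProductSpace.toDual ℝ H).symm.norm_map _
  obtain ⟨φ, hφ⟩ : Module.Dual.eval ℝ X x ∘ₗ ContinuousLinearMap.coeLM ℝ ∈
      LinearMap.range adj.dualMap := by
    rw [LinearMap.range_dualMap_eq_dualAnnihilator_ker, Submodule.mem_dualAnnihilator]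
    intro l hl
    have hle := habs l
    rw [← hadj_norm, LinearMap.mem_ker.1 hl, norm_zero, mul_zero] at hle
    exact abs_nonpos_iff.1 hle
  have hφ_apply (l : StrongDual ℝ X) : φ (adj l) = l x := LinearMap.congr_fun hφ l
  let ψ : StrongDual ℝ (LinearMap.range adj) :=
    (φ.domRestrict (LinearMap.range adj)).mkContinuous M <| by
      rintro ⟨-, l, rfl⟩
      simpa [hφ_apply, hadj_norm] using habs l
  obtain ⟨Ψ, hΨ, hΨ_norm⟩ := exists_extension_norm_eq (LinearMap.range adj) ψ
  refine ⟨(InnerProductSpace.toDual ℝ H).symm Ψ, ?_, ?_⟩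
  · refine (SeparatingDual.eq_iff_forall_dual_eq (R := ℝ)).2 fun l => ?_
    rw [← hadj, real_inner_comm, InnerProductSpace.toDual_symm_apply,
      ← hφ_apply l, hΨ ⟨adj l, l, rfl⟩]
    rfl
  · rw [LinearIsometryEquiv.norm_map, hΨ_norm]
    exact LinearMap.mkContinuous_norm_le _ hM _

lemma imageNorm_le_of_forall_dual {J : H →L[ℝ] X} {x : X} {M : ℝ} (hM : 0 ≤ M)
    (h : ∀ l : StrongDual ℝ X, l x ≤ M * ‖l.comp J‖) : imageNorm J x ≤ ENNReal.ofReal M :=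
  (imageNorm_le_ofReal_iff hM).2 (exists_preimage_norm_le_of_forall_dual hM h)

lemma enorm_dual_apply_le {J : H →L[ℝ] X} {x : X} (l : StrongDual ℝ X)
    (h : imageNorm J x ≠ ∞) : ‖l x‖ₑ ≤ ‖l.comp J‖ₑ * imageNorm J x := by
  obtain ⟨v, rfl, hv⟩ := exists_enorm_eq_imageNorm h
  rw [← hv]
  exact (l.comp J).le_opENorm v

lemma dual_apply_le {J : H →L[ℝ] X} {x : X} {M : ℝ} (hM : 0 ≤ M)
    (h : imageNorm J x ≤ ENNReal.ofReal M) (l : StrongDual ℝ X) : l x ≤ M * ‖l.comp J‖ := by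
  obtain ⟨v, rfl, hv⟩ := (imageNorm_le_ofReal_iff hM).1 h
  calc l (J v) ≤ ‖l.comp J‖ * ‖v‖ := (le_abs_self _).trans ((l.comp J).le_opNorm v)
    _ ≤ M * ‖l.comp J‖ := by rw [mul_comm]; gcongr

lemma lowerSemicontinuous_imageNorm (J : H →L[ℝ] X) : LowerSemicontinuous (imageNorm J) := by
  rw [lowerSemicontinuous_iff_isClosed_preimage]
  intro m
  induction m using ENNReal.recTopCoe with
  | top => simp
  | coe m =>
    have hset : imageNorm J ⁻¹' Iic (m : ℝ≥0∞) =
        ⋂ l : StrongDual ℝ X, {x | l x ≤ m * ‖l.comp J‖} := by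
      ext x
      rw [mem_preimage, mem_Iic, ← ENNReal.ofReal_coe_nnreal, mem_iInter]
      exact ⟨dual_apply_le m.2, imageNorm_le_of_forall_dual m.2⟩
    rw [hset]
    exact isClosed_iInter fun l => isClosed_le l.continuous continuous_const

lemma imageNorm_add_le (J : H →L[ℝ] X) (x y : X) :
    imageNorm J (x + y) ≤ imageNorm J x + imageNorm J y := by
  by_cases hx : imageNorm J x = ∞
  · simp [hx]
  by_cases hy : imageNorm J y = ∞
  · simp [hy]
  obtain ⟨v, rfl, hv⟩ := exists_enorm_eq_imageNorm hx
  obtain ⟨w, rfl, hw⟩ := exists_enorm_eq_imageNorm hy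
  rw [← hv, ← hw, ← map_add]
  exact (imageNorm_apply_le J _).trans (enorm_add_le v w)

lemma imageNorm_smul_le (J : H →L[ℝ] X) (a : ℝ) (x : X) :
    imageNorm J (a • x) ≤ ‖a‖ₑ * imageNorm J x := by
  rcases eq_or_ne a 0 with rfl | ha
  · simp
  by_cases hx : imageNorm J x = ∞
  · simp [hx, ha]
  obtain ⟨v, rfl, hv⟩ := exists_enorm_eq_imageNorm hx
  rw [← hv, ← map_smul, ← enorm_smul]
  exact imageNorm_apply_le J _

/-- Minkowski's inequality, tested against functionals. -/
lemma imageNorm_integral_le {α : Type*} [MeasurableSpace α] {μ : Measure α} [CompleteSpace X]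
    (J : H →L[ℝ] X) (g : α → X) : imageNorm J (∫ a, g a ∂μ) ≤ ∫⁻ a, imageNorm J (g a) ∂μ := by
  borelize X
  by_cases hg : Integrable g μ
  swap
  · simp only [integral_undef hg, imageNorm_zero, zero_le]
  by_cases hfin : ∫⁻ a, imageNorm J (g a) ∂μ = ∞
  · simp [hfin]
  have hmeas : AEMeasurable (fun a => imageNorm J (g a)) μ :=
    (lowerSemicontinuous_imageNorm J).measurable.comp_aemeasurable
      hg.aestronglyMeasurable.aemeasurable
  have hdual (l : StrongDual ℝ X) :
      ‖l (∫ a, g a ∂μ)‖ₑ ≤ ‖l.comp J‖ₑ * ∫⁻ a, imageNorm J (g a) ∂μ := by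
    rw [← l.integral_comp_comm hg, ← lintegral_const_mul' _ _ enorm_ne_top]
    refine (enorm_integral_le_lintegral_enorm _).trans (lintegral_mono_ae ?_)
    filter_upwards [ae_lt_top' hmeas hfin] with a ha using enorm_dual_apply_le l ha.ne
  rw [← ENNReal.ofReal_toReal hfin]
  refine imageNorm_le_of_forall_dual ENNReal.toReal_nonneg fun l => ?_
  have hreal := ENNReal.toReal_mono (ENNReal.mul_ne_top enorm_ne_top hfin) (hdual l)
  rw [ENNReal.toReal_mul, toReal_enorm, toReal_enorm, mul_comm] at hreal
  exact (le_abs_self _).trans hreal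

end ImageNorm

lemma hasDerivWithinAt_Ioi_iff_tendsto_slope_zero {E : Type*} [NormedAddCommGroup E]
    [NormedSpace ℝ E] {f : ℝ → E} {f' : E} {a : ℝ} :
    HasDerivWithinAt f f' (Ioi a) a ↔
      Tendsto (fun h => h⁻¹ • (f (a + h) - f a)) (𝓝[>] 0) (𝓝 f') := by
  have hmap : map (a + ·) (𝓝[>] 0) = 𝓝[>] a := by
    simp
  rw [hasDerivWithinAt_iff_tendsto_slope' (by simp), ← hmap, tendsto_map'_iff]
  simp [slope, Function.comp_def]

namespace C0Semigroup

variable {E : Type*} [NormedAddCommGroup E] [NormedSpace ℝ E] {T S : C0Semigroup E}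

lemma op_add_apply (T : C0Semigroup E) {s t : ℝ} (hs : 0 ≤ s) (ht : 0 ≤ t) (x : E) :
    T.op (s + t) x = T.op s (T.op t x) := by
  rw [T.op_add s t hs ht, ContinuousLinearMap.comp_apply]

@[simp]
lemma op_zero_apply (T : C0Semigroup E) (x : E) : T.op 0 x = x := by
  rw [T.op_zero, ContinuousLinearMap.id_apply]

lemma op_comm_apply (T : C0Semigroup E) {s t : ℝ} (hs : 0 ≤ s) (ht : 0 ≤ t) (x : E) :
    T.op s (T.op t x) = T.op t (T.op s x) := by
  rw [← T.op_add_apply hs ht, ← T.op_add_apply ht hs, add_comm]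

lemma op_sub_op_apply (T : C0Semigroup E) {s t : ℝ} (hs : 0 ≤ s) (hst : s ≤ t) (x : E) :
    T.op (t - s) (T.op s x) = T.op t x := by
  rw [← T.op_add_apply (sub_nonneg.2 hst) hs, sub_add_cancel]

lemma ExpStable.exists_norm_op_le (hT : T.ExpStable) :
    ∃ M : ℝ, 0 < M ∧ ∀ t : ℝ, 0 ≤ t → ‖T.op t‖ ≤ M := by
  obtain ⟨M, ω, hM, hω, hle⟩ := hT
  refine ⟨M, by linarith, fun t ht => (hle t ht).trans ?_⟩
  have hexp : Real.exp (-ω * t) ≤ 1 := Real.exp_le_one_iff.2 (by nlinarith)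
  nlinarith

lemma ExpStable.tendsto_op_apply_atTop (hT : T.ExpStable) (x : E) :
    Tendsto (fun t => T.op t x) atTop (𝓝 0) := by
  obtain ⟨M, ω, -, hω, hle⟩ := hT
  have hexp : Tendsto (fun t : ℝ => M * Real.exp (-ω * t) * ‖x‖) atTop (𝓝 0) := by
    have h := Real.tendsto_exp_atBot.comp
      (tendsto_id.const_mul_atTop_of_neg (neg_neg_of_pos hω))
    simpa [Function.comp_def] using (h.const_mul M).mul_const ‖x‖
  refine squeeze_zero_norm' ?_ hexp
  filter_upwards [eventually_ge_atTop 0] with t ht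
  exact (T.op t).le_of_opNorm_le (hle t ht) x

lemma ExpStable.tendsto_op_apply {α : Type*} {l : Filter α} {a : α → ℝ} {g : α → E} {t : ℝ}
    {x : E} (hT : T.ExpStable) (ht : 0 ≤ t) (ha : Tendsto a l (𝓝[Ici 0] t))
    (hg : Tendsto g l (𝓝 x)) : Tendsto (fun y => T.op (a y) (g y)) l (𝓝 (T.op t x)) := by
  obtain ⟨M, -, hM⟩ := hT.exists_norm_op_le
  have hfixed : Tendsto (fun y => T.op (a y) x) l (𝓝 (T.op t x)) :=
    (T.continuousOn x t ht).tendsto.comp ha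
  have hdiff : Tendsto (fun y => T.op (a y) (g y - x)) l (𝓝 0) := by
    have hnorm : Tendsto (fun y => M * ‖g y - x‖) l (𝓝 0) := by
      simpa using (hg.sub_const x).norm.const_mul M
    refine squeeze_zero_norm' ?_ hnorm
    filter_upwards [ha.eventually self_mem_nhdsWithin] with y hy
    exact (T.op (a y)).le_of_opNorm_le (hM _ hy) _
  simpa using hdiff.add hfixed

lemma ExpStable.continuousOn_op_apply {α : Type*} [TopologicalSpace α] {s : Set α} {a : α → ℝ}
    {g : α → E} (hT : T.ExpStable) (ha : ContinuousOn a s) (ha_nonneg : ∀ y ∈ s, 0 ≤ a y)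
    (hg : ContinuousOn g s) : ContinuousOn (fun y => T.op (a y) (g y)) s := fun y hy =>
  hT.tendsto_op_apply (ha_nonneg y hy)
    (tendsto_nhdsWithin_iff.2 ⟨ha y hy, eventually_mem_nhdsWithin.mono ha_nonneg⟩) (hg y hy)

lemma generatorGraph_unique {x y y' : E} (h : (x, y) ∈ T.generatorGraph)
    (h' : (x, y') ∈ T.generatorGraph) : y = y' :=
  tendsto_nhds_unique h h'

lemma add_mem_generatorGraph {x y x' y' : E} (h : (x, y) ∈ T.generatorGraph)
    (h' : (x', y') ∈ T.generatorGraph) : (x + x', y + y') ∈ T.generatorGraph := by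
  refine (Tendsto.add h h').congr fun t => ?_
  rw [← smul_add, map_add, add_sub_add_comm]

lemma smul_mem_generatorGraph {x y : E} (a : ℝ) (h : (x, y) ∈ T.generatorGraph) :
    (a • x, a • y) ∈ T.generatorGraph := by
  refine (Tendsto.const_smul h a).congr fun t => ?_
  rw [map_smul, ← smul_sub, smul_comm]

lemma op_mem_generatorGraph {x y : E} (h : (x, y) ∈ T.generatorGraph) {t : ℝ} (ht : 0 ≤ t) :
    (T.op t x, T.op t y) ∈ T.generatorGraph := by
  refine (((T.op t).continuous.tendsto y).comp h).congr' ?_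
  filter_upwards [self_mem_nhdsWithin] with r hr
  simp only [Function.comp, map_smul, map_sub]
  rw [T.op_comm_apply (le_of_lt hr) ht]

lemma intervalIntegrable_op (T : C0Semigroup E) (x : E) {a b : ℝ} (ha : 0 ≤ a) (hb : 0 ≤ b) :
    IntervalIntegrable (fun τ => T.op τ x) volume a b :=
  ((T.continuousOn x).mono fun _ hτ => (le_min ha hb).trans hτ.1).intervalIntegrable

lemma hasDerivWithinAt_op_Ioi {x y : E} (h : (x, y) ∈ T.generatorGraph) {t : ℝ} (ht : 0 ≤ t) :
    HasDerivWithinAt (fun τ => T.op τ x) (T.op t y) (Ioi t) t := by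
  rw [hasDerivWithinAt_Ioi_iff_tendsto_slope_zero]
  refine (op_mem_generatorGraph h ht).congr' ?_
  filter_upwards [self_mem_nhdsWithin] with u hu
  rw [add_comm, T.op_add_apply (le_of_lt hu) ht]

lemma IsAnalytic.exists_generator_op {T : C0Semigroup E} (hA : T.IsAnalytic) :
    ∃ (M : ℝ) (D : ℝ → E →L[ℝ] E), 0 < M ∧ ∀ t : ℝ, 0 < t →
      (∀ x, (T.op t x, D t x) ∈ T.generatorGraph) ∧ ‖D t‖ ≤ M / t := by
  obtain ⟨M, hM⟩ := hA
  have hop (t : ℝ) : ∃ D : E →L[ℝ] E, 0 < t →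
      (∀ x, (T.op t x, D x) ∈ T.generatorGraph) ∧ ‖D‖ ≤ (|M| + 1) / t := by
    obtain ht | ht := le_or_gt t 0
    · exact ⟨0, fun h => absurd h ht.not_gt⟩
    choose y hy hyle using hM t ht
    have hle : M / t ≤ (|M| + 1) / t := by
      gcongr
      linarith [le_abs_self M]
    let L : E →ₗ[ℝ] E :=
      { toFun := y
        map_add' := fun u v => generatorGraph_unique (hy (u + v)) (by
          rw [map_add]; exact add_mem_generatorGraph (hy u) (hy v))
        map_smul' := fun c u => generatorGraph_unique (hy (c • u)) (by
          rw [map_smul]; exact smul_mem_generatorGraph c (hy u)) }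
    refine ⟨L.mkContinuous ((|M| + 1) / t) fun x => (hyle x).trans ?_, fun _ => ⟨hy, ?_⟩⟩
    · exact mul_le_mul_of_nonneg_right hle (norm_nonneg x)
    · exact L.mkContinuous_norm_le (by positivity) _
  choose D hD using hop
  exact ⟨|M| + 1, D, by positivity, hD⟩

variable [CompleteSpace E]

lemma tendsto_average (T : C0Semigroup E) (x : E) {a : ℝ} (ha : 0 ≤ a) :
    Tendsto (fun h : ℝ => h⁻¹ • ∫ τ in a..(a + h), T.op τ x) (𝓝[>] 0) (𝓝 (T.op a x)) := by
  have hcont : ContinuousOn (fun τ => T.op τ x) (Ioi a) :=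
    (T.continuousOn x).mono fun _ hτ => ha.trans (le_of_lt hτ)
  have hprim := intervalIntegral.integral_hasDerivWithinAt_right (s := Ici a) (t := Ioi a)
    (T.intervalIntegrable_op x ha ha)
    ⟨Ioi a, self_mem_nhdsWithin, hcont.aestronglyMeasurable measurableSet_Ioi⟩
    ((T.continuousOn x a ha).mono fun _ hτ => ha.trans (le_of_lt hτ))
  simpa using hasDerivWithinAt_Ioi_iff_tendsto_slope_zero.1 (hprim.mono Ioi_subset_Ici_self)

lemma op_sub_op_eq_integral {x y : E} (h : (x, y) ∈ T.generatorGraph) {a b : ℝ} (ha : 0 ≤ a)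
    (hab : a ≤ b) : T.op b x - T.op a x = ∫ τ in a..b, T.op τ y :=
  (intervalIntegral.integral_eq_sub_of_hasDeriv_right_of_le hab
    ((T.continuousOn x).mono fun _ hτ => ha.trans hτ.1)
    (fun _ ht => hasDerivWithinAt_op_Ioi h (ha.trans ht.1.le))
    (T.intervalIntegrable_op y ha (ha.trans hab))).symm

lemma hasDerivAt_op {x y : E} (h : (x, y) ∈ T.generatorGraph) {t : ℝ} (ht : 0 < t) :
    HasDerivAt (fun τ => T.op τ x) (T.op t y) t := by
  have hmeas : StronglyMeasurableAtFilter (fun τ => T.op τ y) (𝓝 t) volume :=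
    ((T.continuousOn y).mono Ioi_subset_Ici_self).stronglyMeasurableAtFilter isOpen_Ioi t ht
  have hprim := (intervalIntegral.integral_hasDerivAt_right
    (T.intervalIntegrable_op y le_rfl ht.le) hmeas
    ((T.continuousOn y).continuousAt (Ici_mem_nhds ht))).add_const x
  refine hprim.congr_of_eventuallyEq ?_
  filter_upwards [Ioi_mem_nhds ht] with τ hτ
  rw [← op_sub_op_eq_integral h le_rfl (le_of_lt hτ), T.op_zero_apply, sub_add_cancel]

lemma ExpStable.hasDerivAt_op_sub_apply (hT : T.ExpStable) {u : ℝ → E} {u' w : E} {t τ : ℝ}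
    (hτ : τ < t) (hu : HasDerivAt u u' τ) (hw : (u τ, w) ∈ T.generatorGraph) :
    HasDerivAt (fun σ => T.op (t - σ) (u σ)) (T.op (t - τ) (u' - w)) τ := by
  have hpos : 0 < t - τ := sub_pos.2 hτ
  have hop : HasDerivAt (fun σ => T.op (t - σ) (u τ)) (-T.op (t - τ) w) τ :=
    (hasDerivAt_op hw hpos).comp_const_sub t τ
  have hvec : HasDerivAt (fun σ => T.op (t - σ) (u σ - u τ)) (T.op (t - τ) u') τ := by
    rw [hasDerivAt_iff_tendsto_slope] at hu ⊢
    have ha : Tendsto (fun σ => t - σ) (𝓝[≠] τ) (𝓝[Ici 0] (t - τ)) :=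
      tendsto_nhdsWithin_iff.2 ⟨(tendsto_id.const_sub t).mono_left nhdsWithin_le_nhds,
        ((eventually_lt_nhds hτ).filter_mono nhdsWithin_le_nhds).mono
          fun _ hσ => sub_nonneg.2 hσ.le⟩
    refine (hT.tendsto_op_apply hpos.le ha hu).congr fun σ => ?_
    simp [slope]
  have hsum := hvec.add hop
  rw [← sub_eq_add_neg, ← map_sub] at hsum
  refine hsum.congr_of_eventuallyEq (Eventually.of_forall fun σ => ?_)
  simp

/-- Variation of constants: if `A` and `A - G` generate `S` and `T` and `g τ = G (S τ x)`, then
`T (t - τ) (S τ x)` has derivative `T (t - τ) (g τ)` in `τ`. -/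
lemma ExpStable.op_eq_add_integral (hT : T.ExpStable) {x w : E} (hx : (x, w) ∈ S.generatorGraph)
    {g : ℝ → E} (hg : ContinuousOn g (Ici 0))
    (hgen : ∀ τ, 0 ≤ τ → (S.op τ x, S.op τ w - g τ) ∈ T.generatorGraph) {t : ℝ} (ht : 0 ≤ t) :
    S.op t x = T.op t x + ∫ τ in (0 : ℝ)..t, T.op (t - τ) (g τ) := by
  have hsub : ContinuousOn (fun τ => t - τ) (Icc 0 t) := continuousOn_const.sub continuousOn_id
  have hnonneg : ∀ τ ∈ Icc 0 t, 0 ≤ t - τ := fun τ hτ => sub_nonneg.2 hτ.2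
  have hderiv : ∀ τ ∈ Ioo 0 t,
      HasDerivAt (fun σ => T.op (t - σ) (S.op σ x)) (T.op (t - τ) (g τ)) τ := fun τ hτ => by
    simpa using hT.hasDerivAt_op_sub_apply hτ.2 (hasDerivAt_op hx hτ.1) (hgen τ hτ.1.le)
  have hftc := intervalIntegral.integral_eq_sub_of_hasDerivAt_of_le ht
    (hT.continuousOn_op_apply hsub hnonneg ((S.continuousOn x).mono Icc_subset_Ici_self)) hderiv
    (ContinuousOn.intervalIntegrable_of_Icc ht
      (hT.continuousOn_op_apply hsub hnonneg (hg.mono Icc_subset_Ici_self)))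
  simp [hftc]

lemma op_integral_op (T : C0Semigroup E) (x : E) {h t : ℝ} (hh : 0 ≤ h) (ht : 0 ≤ t) :
    T.op h (∫ τ in (0 : ℝ)..t, T.op τ x) = ∫ τ in h..(h + t), T.op τ x := by
  rw [← (T.op h).intervalIntegral_comp_comm (T.intervalIntegrable_op x le_rfl ht)]
  calc ∫ τ in (0 : ℝ)..t, T.op h (T.op τ x) = ∫ τ in (0 : ℝ)..t, T.op (h + τ) x :=
        intervalIntegral.integral_congr fun τ hτ => by
          rw [uIcc_of_le ht] at hτ
          exact (T.op_add_apply hh hτ.1 x).symm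
    _ = ∫ τ in h..(h + t), T.op τ x := by
        simpa using intervalIntegral.integral_comp_add_left (fun τ => T.op τ x) h (a := 0) (b := t)

lemma integral_mem_generatorGraph (T : C0Semigroup E) (x : E) {t : ℝ} (ht : 0 ≤ t) :
    (∫ τ in (0 : ℝ)..t, T.op τ x, T.op t x - x) ∈ T.generatorGraph := by
  have hint {a b : ℝ} (ha : 0 ≤ a) (hb : 0 ≤ b) := T.intervalIntegrable_op x ha hb
  have haverage := (T.tendsto_average x ht).sub (T.tendsto_average x le_rfl)
  rw [T.op_zero_apply] at haverage
  refine haverage.congr' ?_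
  filter_upwards [self_mem_nhdsWithin] with h hh
  have hh : 0 ≤ h := le_of_lt hh
  rw [T.op_integral_op x hh ht, ← smul_sub, zero_add,
    intervalIntegral.integral_interval_sub_interval_comm' (hint ht (by positivity))
      (hint le_rfl hh) (hint ht le_rfl), add_comm t h]

lemma dense_domain (T : C0Semigroup E) : Dense {x : E | ∃ y, (x, y) ∈ T.generatorGraph} := by
  intro x
  have haverage := T.tendsto_average x le_rfl
  rw [T.op_zero_apply] at haverage
  refine mem_closure_of_tendsto haverage ?_
  filter_upwards [self_mem_nhdsWithin] with h hh
  rw [zero_add]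
  exact ⟨_, smul_mem_generatorGraph _ (T.integral_mem_generatorGraph x (le_of_lt hh))⟩

lemma norm_op_sub_op_le {D : E →L[ℝ] E} {M t₀ a b : ℝ} (hM : ∀ t, 0 ≤ t → ‖T.op t‖ ≤ M)
    (ht₀ : 0 ≤ t₀) (hD : ∀ x, (T.op t₀ x, D x) ∈ T.generatorGraph) (ha : t₀ ≤ a) (hab : a ≤ b) :
    ‖T.op b - T.op a‖ ≤ M * ‖D‖ * (b - a) := by
  have hM0 : 0 ≤ M := (norm_nonneg _).trans (hM 0 le_rfl)
  refine ContinuousLinearMap.opNorm_le_bound _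
    (mul_nonneg (by positivity) (sub_nonneg.2 hab)) fun x => ?_
  have hdiff : (T.op b - T.op a) x = ∫ τ in (a - t₀)..(b - t₀), T.op τ (D x) := by
    rw [← op_sub_op_eq_integral (hD x) (sub_nonneg.2 ha) (sub_le_sub_right hab t₀),
      T.op_sub_op_apply ht₀ ha, T.op_sub_op_apply ht₀ (ha.trans hab)]
    rfl
  have hbound : ∀ τ ∈ uIoc (a - t₀) (b - t₀), ‖T.op τ (D x)‖ ≤ M * (‖D‖ * ‖x‖) := fun τ hτ => by
    rw [uIoc_of_le (sub_le_sub_right hab t₀)] at hτ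
    have hτ0 : 0 ≤ τ := (sub_nonneg.2 ha).trans hτ.1.le
    calc ‖T.op τ (D x)‖ ≤ M * ‖D x‖ := (T.op τ).le_of_opNorm_le (hM τ hτ0) _
      _ ≤ M * (‖D‖ * ‖x‖) := by gcongr; exact D.le_opNorm x
  calc ‖(T.op b - T.op a) x‖ ≤ M * (‖D‖ * ‖x‖) * |b - t₀ - (a - t₀)| :=
        hdiff ▸ intervalIntegral.norm_integral_le_of_norm_le_const hbound
    _ = M * ‖D‖ * (b - a) * ‖x‖ := by
        rw [sub_sub_sub_cancel_right, abs_of_nonneg (sub_nonneg.2 hab)]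
        ring

lemma IsAnalytic.continuousOn_op (hA : T.IsAnalytic) (hT : T.ExpStable) :
    ContinuousOn T.op (Ioi 0) := by
  obtain ⟨M, hM0, hM⟩ := hT.exists_norm_op_le
  obtain ⟨_, D, -, hD⟩ := hA.exists_generator_op
  intro t ht
  have ht2 : 0 < t / 2 := half_pos ht
  have hlip : LipschitzOnWith (M * ‖D (t / 2)‖).toNNReal T.op (Ici (t / 2)) := by
    refine LipschitzOnWith.of_dist_le_mul fun a ha b hb => ?_
    rw [Real.coe_toNNReal _ (by positivity), dist_eq_norm, Real.dist_eq]
    have hle {a b : ℝ} := norm_op_sub_op_le (a := a) (b := b) hM ht2.le (hD _ ht2).1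
    obtain hab | hab := le_total a b
    · rw [norm_sub_rev, abs_sub_comm, abs_of_nonneg (sub_nonneg.2 hab)]
      exact hle ha hab
    · rw [abs_of_nonneg (sub_nonneg.2 hab)]
      exact hle hb hab
  exact (hlip.continuousOn.continuousAt (Ici_mem_nhds (half_lt_self ht))).continuousWithinAt

lemma integrableOn_rpow_smul_op (hT : T.ExpStable) (hA : T.IsAnalytic) {s : ℝ} (hs : 0 < s) :
    IntegrableOn (fun t : ℝ => t ^ (s - 1) • T.op t) (Ioi 0) := by
  have hcont : ContinuousOn (fun t : ℝ => t ^ (s - 1) • T.op t) (Ioi 0) :=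
    (continuousOn_id.rpow_const fun t ht => Or.inl (ne_of_gt ht)).smul (hA.continuousOn_op hT)
  obtain ⟨M, ω, -, hω, hM⟩ := hT
  refine Integrable.mono' ((integrableOn_rpow_mul_exp_neg_mul_rpow (s := s - 1) (p := 1)
    (by linarith) one_pos hω).const_mul M) (hcont.aestronglyMeasurable measurableSet_Ioi) ?_
  refine (ae_restrict_iff' measurableSet_Ioi).2 (Eventually.of_forall fun t (ht : 0 < t) => ?_)
  rw [norm_smul, Real.norm_of_nonneg (by positivity), Real.rpow_one, mul_left_comm]
  gcongr
  exact hM t ht.le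

end C0Semigroup

section NegPow

lemma integral_rpow_mul_sub_rpow {a b x : ℝ} (ha : 0 < a) (hb : 0 < b) (hx : 0 < x) :
    ∫ t in (0 : ℝ)..x, t ^ (a - 1) * (x - t) ^ (b - 1) =
      x ^ (a + b - 1) * ProbabilityTheory.beta a b := by
  have hcomplex : (∫ t in (0 : ℝ)..x, (t : ℂ) ^ ((a : ℂ) - 1) * ((x : ℂ) - t) ^ ((b : ℂ) - 1)) =
      ((∫ t in (0 : ℝ)..x, t ^ (a - 1) * (x - t) ^ (b - 1) : ℝ) : ℂ) := by
    rw [← intervalIntegral.integral_ofReal]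
    refine intervalIntegral.integral_congr fun t ht => ?_
    rw [uIcc_of_le hx.le] at ht
    rw [Complex.ofReal_mul, Complex.ofReal_cpow ht.1, Complex.ofReal_cpow (sub_nonneg.2 ht.2)]
    push_cast
    rfl
  have hpow : (x : ℂ) ^ ((a : ℂ) + b - 1) = ((x ^ (a + b - 1) : ℝ) : ℂ) := by
    rw [Complex.ofReal_cpow hx.le]
    push_cast
    rfl
  have hscaled := congrArg Complex.re (Complex.betaIntegral_scaled (a : ℂ) (b : ℂ) hx)
  rwa [hcomplex, hpow, Complex.ofReal_re, Complex.re_ofReal_mul,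
    ← ProbabilityTheory.beta_eq_betaIntegralReal a b ha hb] at hscaled

variable {Z : Type*} [NormedAddCommGroup Z] [InnerProductSpace ℝ Z]
  {T : C0Semigroup Z}

lemma negPow_zero (T : C0Semigroup Z) : negPow T 0 = ContinuousLinearMap.id ℝ Z := if_pos rfl

lemma negPow_of_pos (T : C0Semigroup Z) {s : ℝ} (hs : 0 < s) :
    negPow T s = (Real.Gamma s)⁻¹ • ∫ t in Ioi (0 : ℝ), t ^ (s - 1) • T.op t :=
  if_neg hs.ne'

variable [CompleteSpace Z]

lemma negPow_apply (hT : T.ExpStable) (hA : T.IsAnalytic) {s : ℝ} (hs : 0 < s) (x : Z) :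
    negPow T s x = (Real.Gamma s)⁻¹ • ∫ t in Ioi (0 : ℝ), t ^ (s - 1) • T.op t x := by
  rw [negPow_of_pos T hs, smul_apply, ContinuousLinearMap.integral_apply
    (C0Semigroup.integrableOn_rpow_smul_op hT hA hs)]
  rfl

lemma negPow_comp_negPow (hT : T.ExpStable) (hA : T.IsAnalytic) {a b : ℝ} (ha : 0 < a)
    (hb : 0 < b) : (negPow T a).comp (negPow T b) = negPow T (a + b) := by
  have hab : 0 < a + b := add_pos ha hb
  have hconv := integral_posConvolution (C0Semigroup.integrableOn_rpow_smul_op hT hA ha)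
    (C0Semigroup.integrableOn_rpow_smul_op hT hA hb) (ContinuousLinearMap.compL ℝ Z Z Z)
  have hinner : ∀ y ∈ Ioi (0 : ℝ), (∫ t in (0 : ℝ)..y, ContinuousLinearMap.compL ℝ Z Z Z
      (t ^ (a - 1) • T.op t) ((y - t) ^ (b - 1) • T.op (y - t))) =
      ProbabilityTheory.beta a b • (y ^ (a + b - 1) • T.op y) := fun y (hy : 0 < y) => by
    rw [smul_smul, mul_comm, ← integral_rpow_mul_sub_rpow ha hb hy]
    refine Eq.trans ?_ (intervalIntegral.integral_smul_const _ _)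
    refine intervalIntegral.integral_congr fun t ht => ?_
    rw [uIcc_of_le hy.le] at ht
    have hop : (T.op t).comp (T.op (y - t)) = T.op y := by
      rw [← T.op_add t (y - t) ht.1 (sub_nonneg.2 ht.2), add_sub_cancel]
    simp only [ContinuousLinearMap.compL_apply, ContinuousLinearMap.smul_comp,
      ContinuousLinearMap.comp_smul, smul_smul, hop, mul_comm]
  rw [setIntegral_congr_fun measurableSet_Ioi hinner, integral_smul,
    ContinuousLinearMap.compL_apply] at hconv
  rw [negPow_of_pos T ha, negPow_of_pos T hb, negPow_of_pos T hab,
    ContinuousLinearMap.smul_comp, ContinuousLinearMap.comp_smul, ← hconv, smul_smul, smul_smul,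
    ProbabilityTheory.beta]
  congr 1
  field_simp

lemma negPow_negPow (hT : T.ExpStable) (hA : T.IsAnalytic) {a b : ℝ} (ha : 0 ≤ a) (hb : 0 ≤ b)
    (x : Z) : negPow T a (negPow T b x) = negPow T (a + b) x := by
  obtain rfl | ha := ha.eq_or_lt
  · simp [negPow_zero]
  obtain rfl | hb := hb.eq_or_lt
  · simp [negPow_zero]
  rw [← negPow_comp_negPow hT hA ha hb, ContinuousLinearMap.comp_apply]

lemma tendsto_integral_op_negPow_one (hT : T.ExpStable) (hA : T.IsAnalytic) (x : Z) :
    Tendsto (fun t => ∫ τ in (0 : ℝ)..t, T.op τ x) atTop (𝓝 (negPow T 1 x)) := by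
  have hint : IntegrableOn (fun τ => T.op τ x) (Ioi 0) := by
    simpa [IntegrableOn] using
      (C0Semigroup.integrableOn_rpow_smul_op hT hA one_pos).apply_continuousLinearMap x
  simpa [negPow_apply hT hA one_pos] using
    intervalIntegral_tendsto_integral_Ioi 0 hint tendsto_id

lemma op_negPow_one (hT : T.ExpStable) (hA : T.IsAnalytic) (x : Z) {h : ℝ} (hh : 0 ≤ h) :
    T.op h (negPow T 1 x) = negPow T 1 x - ∫ τ in (0 : ℝ)..h, T.op τ x := by
  have hlim := tendsto_integral_op_negPow_one hT hA x
  refine tendsto_nhds_unique (((T.op h).continuous.tendsto _).comp hlim)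
    (((hlim.comp (tendsto_atTop_add_const_left _ h tendsto_id)).sub_const _).congr' ?_)
  filter_upwards [eventually_ge_atTop 0] with t ht
  simp only [Function.comp_apply, id_eq, T.op_integral_op x hh ht]
  exact intervalIntegral.integral_interval_sub_left
    (T.intervalIntegrable_op x le_rfl (add_nonneg hh ht)) (T.intervalIntegrable_op x le_rfl hh)

lemma mem_generatorGraph_iff (hT : T.ExpStable) (hA : T.IsAnalytic) {x y : Z} :
    (x, y) ∈ T.generatorGraph ↔ x = -negPow T 1 y := by
  refine ⟨fun h => ?_, ?_⟩
  · have hlim : Tendsto (fun t => ∫ τ in (0 : ℝ)..t, T.op τ y) atTop (𝓝 (0 - x)) := by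
      refine ((hT.tendsto_op_apply_atTop x).sub_const x).congr' ?_
      filter_upwards [eventually_ge_atTop 0] with t ht
      rw [← C0Semigroup.op_sub_op_eq_integral h le_rfl ht, T.op_zero_apply]
    rw [tendsto_nhds_unique (tendsto_integral_op_negPow_one hT hA y) hlim, zero_sub, neg_neg]
  · rintro rfl
    have haverage := T.tendsto_average y le_rfl
    rw [T.op_zero_apply] at haverage
    refine haverage.congr' ?_
    filter_upwards [self_mem_nhdsWithin] with h hh
    rw [map_neg, op_negPow_one hT hA y (le_of_lt hh), zero_add]
    congr 1
    abel

lemma negPow_one_injective (hT : T.ExpStable) (hA : T.IsAnalytic) :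
    Function.Injective (negPow T 1) := fun u v h =>
  C0Semigroup.generatorGraph_unique ((mem_generatorGraph_iff hT hA).2 (by rw [h]))
    ((mem_generatorGraph_iff hT hA).2 (rfl : -negPow T 1 v = _))

lemma negPow_injective (hT : T.ExpStable) (hA : T.IsAnalytic) {s : ℝ} (hs : 0 ≤ s)
    (hs1 : s ≤ 1) : Function.Injective (negPow T s) := by
  intro u v h
  have hadd := negPow_negPow hT hA (sub_nonneg.2 hs1) hs
  rw [sub_add_cancel] at hadd
  exact negPow_one_injective hT hA (by rw [← hadd, ← hadd, h])

lemma denseRange_negPow (hT : T.ExpStable) (hA : T.IsAnalytic) {s : ℝ} (hs : 0 ≤ s)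
    (hs1 : s ≤ 1) : DenseRange (negPow T s) := by
  refine T.dense_domain.mono ?_
  rintro x ⟨y, hy⟩
  refine ⟨negPow T (1 - s) (-y), ?_⟩
  rw [negPow_negPow hT hA hs (sub_nonneg.2 hs1), add_sub_cancel, map_neg,
    (mem_generatorGraph_iff hT hA).1 hy]

end NegPow

/-! ### Semigroups that factor through a smaller space -/

section Factors

variable {E F : Type*} [NormedAddCommGroup E] [NormedSpace ℝ E] [NormedAddCommGroup F]
  [NormedSpace ℝ F] {S : C0Semigroup E} {J : F →L[ℝ] E} {W : ℝ → E →L[ℝ] F} {k : ℝ → ℝ}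

/-- `S t = J ∘ W t` for `t > 0`, where `‖W t‖ ≤ k t`: the semigroup maps `E` into the space `F`,
embedded in `E` by `J`, with norm at most `k t`. -/
structure Factors (S : C0Semigroup E) (J : F →L[ℝ] E) (W : ℝ → E →L[ℝ] F) (k : ℝ → ℝ) :
    Prop where
  injective : Function.Injective J
  map_apply : ∀ t, 0 < t → ∀ x, J (W t x) = S.op t x
  norm_le : ∀ t, 0 < t → ‖W t‖ ≤ k t

namespace Factors

lemma norm_apply_le (h : Factors S J W k) {t : ℝ} (ht : 0 < t) (x : E) :
    ‖W t x‖ ≤ k t * ‖x‖ :=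
  (W t).le_of_opNorm_le (h.norm_le t ht) x

lemma apply_op (h : Factors S J W k) {s t : ℝ} (hs : 0 < s) (hst : s ≤ t) (x : E) :
    W s (S.op (t - s) x) = W t x := by
  refine h.injective ?_
  rw [h.map_apply s hs, h.map_apply t (hs.trans_le hst),
    ← S.op_add_apply hs.le (sub_nonneg.2 hst), add_sub_cancel]

lemma continuousOn_apply (h : Factors S J W k) (hS : S.ExpStable) {α : Type*} [TopologicalSpace α]
    {s : Set α} {a : α → ℝ} {g : α → E} (ha : ContinuousOn a s) (ha_pos : ∀ y ∈ s, 0 < a y)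
    (hg : ContinuousOn g s) : ContinuousOn (fun y => W (a y) (g y)) s := by
  intro y hy
  have hpos : 0 < a y / 2 := half_pos (ha_pos y hy)
  have hlt : a y / 2 < a y := half_lt_self (ha_pos y hy)
  have hev : ∀ᶠ z in 𝓝[s] y, a y / 2 ≤ a z := (ha y hy).eventually (Ici_mem_nhds hlt)
  have hop : Tendsto (fun z => S.op (a z - a y / 2) (g z)) (𝓝[s] y)
      (𝓝 (S.op (a y - a y / 2) (g y))) :=
    hS.tendsto_op_apply (sub_nonneg.2 hlt.le) (tendsto_nhdsWithin_iff.2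
      ⟨(ha y hy).sub_const _, hev.mono fun z hz => sub_nonneg.2 hz⟩) (hg y hy)
  have hW := ((W (a y / 2)).continuous.tendsto _).comp hop
  rw [h.apply_op hpos hlt.le] at hW
  exact hW.congr' (hev.mono fun z hz => h.apply_op hpos hz _)

lemma intervalIntegrable_conv (h : Factors S J W k) (hS : S.ExpStable) {G : ℝ → E} {a t : ℝ}
    (hat : a ≤ t) (hk : IntervalIntegrable k volume 0 (t - a)) (hG : ContinuousOn G (Icc a t)) :
    IntervalIntegrable (fun τ => W (t - τ) (G τ)) volume a t := by
  have hkt : IntervalIntegrable (fun τ => k (t - τ) * ‖G τ‖) volume a t := by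
    have hsub := (hk.comp_sub_left t).symm
    rw [sub_zero, sub_sub_cancel] at hsub
    exact hsub.mul_continuousOn (by rw [uIcc_of_le hat]; exact hG.norm)
  refine hkt.mono_fun' ?_ ?_ <;> rw [uIoc_of_le hat, ← restrict_Ioo_eq_restrict_Ioc]
  · exact (h.continuousOn_apply hS (continuousOn_const.sub continuousOn_id)
      (fun τ hτ => sub_pos.2 hτ.2)
      (hG.mono Ioo_subset_Icc_self)).aestronglyMeasurable measurableSet_Ioo
  · exact (ae_restrict_iff' measurableSet_Ioo).2 (Eventually.of_forall fun τ hτ =>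
      h.norm_apply_le (sub_pos.2 hτ.2) _)

lemma map_integral_conv [CompleteSpace E] [CompleteSpace F] (h : Factors S J W k)
    (hS : S.ExpStable) {G : ℝ → E} {a t : ℝ} (hat : a ≤ t)
    (hk : IntervalIntegrable k volume 0 (t - a)) (hG : ContinuousOn G (Icc a t)) :
    J (∫ τ in a..t, W (t - τ) (G τ)) = ∫ τ in a..t, S.op (t - τ) (G τ) := by
  rw [← J.intervalIntegral_comp_comm (h.intervalIntegrable_conv hS hat hk hG),
    intervalIntegral.integral_of_le hat, intervalIntegral.integral_of_le hat,
    integral_Ioc_eq_integral_Ioo, integral_Ioc_eq_integral_Ioo]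
  exact setIntegral_congr_fun measurableSet_Ioo fun τ hτ => h.map_apply _ (sub_pos.2 hτ.2) _

lemma integrableOn_apply (h : Factors S J W k) (hS : S.ExpStable) (hk : IntegrableOn k (Ioi 0))
    (x : E) : IntegrableOn (fun τ => W τ x) (Ioi 0) := by
  refine Integrable.mono' (hk.mul_const ‖x‖) ?_ ?_
  · exact (h.continuousOn_apply hS continuousOn_id (fun t ht => ht)
      continuousOn_const).aestronglyMeasurable measurableSet_Ioi
  · exact (ae_restrict_iff' measurableSet_Ioi).2
      (Eventually.of_forall fun t ht => h.norm_apply_le ht x)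

end Factors
end Factors

/-! ### Weakly singular kernels -/

section Singular

lemma intervalIntegrable_sub_rpow_neg {α : ℝ} (hα : α < 1) (t : ℝ) :
    IntervalIntegrable (fun τ : ℝ => (t - τ) ^ (-α)) volume 0 t := by
  have h := (intervalIntegral.intervalIntegrable_rpow' (a := 0) (b := t)
    (show -1 < -α by linarith)).comp_sub_left t
  simpa using h.symm

lemma integral_sub_rpow_mul_le {α m s : ℝ} {p : ℝ → ℝ} (hα : α < 1) (hs : 0 < s)
    (hp : ContinuousOn p (Icc 0 s)) (hle : ∀ τ ∈ Ioo 0 s, p τ ≤ m * τ ^ (-α)) :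
    ∫ τ in (0 : ℝ)..s, (s - τ) ^ (-α) * p τ ≤
      m * (s ^ (1 - 2 * α) * ProbabilityTheory.beta (1 - α) (1 - α)) := by
  have h1α : 0 < 1 - α := sub_pos.2 hα
  have hbeta : ∫ τ in (0 : ℝ)..s, τ ^ (-α) * (s - τ) ^ (-α) =
      s ^ (1 - 2 * α) * ProbabilityTheory.beta (1 - α) (1 - α) := by
    convert integral_rpow_mul_sub_rpow h1α h1α hs using 3 <;> ring_nf
  have hint : IntervalIntegrable (fun τ : ℝ => τ ^ (-α) * (s - τ) ^ (-α)) volume 0 s := by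
    by_contra h
    rw [intervalIntegral.integral_undef h] at hbeta
    have := ProbabilityTheory.beta_pos h1α h1α
    have : 0 < s ^ (1 - 2 * α) * ProbabilityTheory.beta (1 - α) (1 - α) := by positivity
    linarith
  rw [← hbeta, ← intervalIntegral.integral_const_mul]
  refine intervalIntegral.integral_mono_on_of_le_Ioo hs.le
    ((intervalIntegrable_sub_rpow_neg hα s).mul_continuousOn (by rwa [uIcc_of_le hs.le]))
    (hint.const_mul m) fun τ hτ => ?_
  calc (s - τ) ^ (-α) * p τ ≤ (s - τ) ^ (-α) * (m * τ ^ (-α)) :=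
        mul_le_mul_of_nonneg_left (hle τ hτ) (Real.rpow_nonneg (sub_nonneg.2 hτ.2.le) _)
    _ = m * (τ ^ (-α) * (s - τ) ^ (-α)) := by ring

lemma rpow_mul_integral_sub_rpow_mul_le {α m s : ℝ} {p : ℝ → ℝ} (hα : α < 1) (hs : 0 < s)
    (hp : ContinuousOn p (Icc 0 s)) (hle : ∀ τ ∈ Ioo 0 s, p τ ≤ m * τ ^ (-α)) :
    s ^ α * ∫ τ in (0 : ℝ)..s, (s - τ) ^ (-α) * p τ ≤
      m * (s ^ (1 - α) * ProbabilityTheory.beta (1 - α) (1 - α)) := by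
  have hexp : s ^ (1 - α) = s ^ α * s ^ (1 - 2 * α) := by
    rw [← Real.rpow_add hs]
    congr 1
    ring
  refine (mul_le_mul_of_nonneg_left (integral_sub_rpow_mul_le hα hs hp hle)
    (Real.rpow_nonneg hs.le α)).trans_eq ?_
  rw [hexp]
  ring

/-- The maximum `m` of `t ^ α * p t` satisfies `m ≤ N + m / 2`. -/
lemma le_of_le_add_integral_sub_rpow {α δ κ N : ℝ} (hα0 : 0 < α) (hα : α < 1) (hκ : 0 ≤ κ)
    (hN : 0 ≤ N) (hδ : κ * (δ ^ (1 - α) * ProbabilityTheory.beta (1 - α) (1 - α)) ≤ 1 / 2)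
    {p : ℝ → ℝ} (hp : ContinuousOn p (Icc 0 δ))
    (hle : ∀ t ∈ Ioc 0 δ, p t ≤ N * t ^ (-α) + κ * ∫ τ in (0 : ℝ)..t, (t - τ) ^ (-α) * p τ)
    {t : ℝ} (ht : t ∈ Ioc 0 δ) : p t ≤ 2 * N * t ^ (-α) := by
  have hδ0 : 0 ≤ δ := ht.1.le.trans ht.2
  have hcont : ContinuousOn (fun t : ℝ => t ^ α * p t) (Icc 0 δ) :=
    (continuousOn_id.rpow_const fun _ _ => Or.inr hα0.le).mul hp
  obtain ⟨s, hs, hmax⟩ := isCompact_Icc.exists_isMaxOn (nonempty_Icc.2 hδ0) hcont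
  set m := s ^ α * p s with hm
  have hpm : ∀ t ∈ Ioc 0 δ, p t ≤ m * t ^ (-α) := fun t ht => by
    rw [Real.rpow_neg ht.1.le, ← div_eq_mul_inv, le_div_iff₀ (Real.rpow_pos_of_pos ht.1 _),
      mul_comm]
    exact hmax (Ioc_subset_Icc_self ht)
  have hm0 : 0 ≤ m := by simpa [Real.zero_rpow hα0.ne'] using hmax (left_mem_Icc.2 hδ0)
  suffices hmN : m ≤ 2 * N from
    (hpm t ht).trans (mul_le_mul_of_nonneg_right hmN (Real.rpow_nonneg ht.1.le _))
  obtain hs0 | hs0 := hs.1.eq_or_lt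
  · rw [hm, ← hs0, Real.zero_rpow hα0.ne', zero_mul]
    positivity
  set B := ProbabilityTheory.beta (1 - α) (1 - α)
  have hB : 0 < B := ProbabilityTheory.beta_pos (sub_pos.2 hα) (sub_pos.2 hα)
  have hint : s ^ α * ∫ τ in (0 : ℝ)..s, (s - τ) ^ (-α) * p τ ≤ m * (s ^ (1 - α) * B) :=
    rpow_mul_integral_sub_rpow_mul_le hα hs0 (hp.mono (Icc_subset_Icc_right hs.2))
      fun τ hτ => hpm τ ⟨hτ.1, hτ.2.le.trans hs.2⟩
  have hinv : s ^ α * s ^ (-α) = 1 := by rw [← Real.rpow_add hs0, add_neg_cancel, Real.rpow_zero]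
  have hhalf : m ≤ N + m * (1 / 2) := calc
    m ≤ s ^ α * (N * s ^ (-α) + κ * ∫ τ in (0 : ℝ)..s, (s - τ) ^ (-α) * p τ) :=
        mul_le_mul_of_nonneg_left (hle s ⟨hs0, hs.2⟩) (Real.rpow_nonneg hs0.le α)
    _ = N + κ * (s ^ α * ∫ τ in (0 : ℝ)..s, (s - τ) ^ (-α) * p τ) := by
        linear_combination N * hinv
    _ ≤ N + κ * (m * (s ^ (1 - α) * B)) := by gcongr
    _ ≤ N + m * (κ * (δ ^ (1 - α) * B)) := by
        rw [mul_left_comm κ]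
        gcongr
        exact hs.2
    _ ≤ N + m * (1 / 2) := by gcongr
  linarith

lemma exists_singular_gronwall {α κ : ℝ} (hα0 : 0 < α) (hα : α < 1) (hκ : 0 ≤ κ) :
    ∃ δ : ℝ, 0 < δ ∧ ∀ (N : ℝ) (p : ℝ → ℝ), 0 ≤ N → ContinuousOn p (Icc 0 δ) →
      (∀ t ∈ Ioc 0 δ, p t ≤ N * t ^ (-α) + κ * ∫ τ in (0 : ℝ)..t, (t - τ) ^ (-α) * p τ) →
      ∀ t ∈ Ioc 0 δ, p t ≤ 2 * N * t ^ (-α) := by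
  have h1α : 0 < 1 - α := sub_pos.2 hα
  set B := ProbabilityTheory.beta (1 - α) (1 - α)
  have hlim : Tendsto (fun δ : ℝ => κ * (δ ^ (1 - α) * B)) (𝓝 0) (𝓝 0) := by
    simpa [Real.zero_rpow h1α.ne'] using
      ((Real.continuousAt_rpow_const 0 (1 - α) (Or.inr h1α.le)).tendsto.mul_const B).const_mul κ
  have hev : ∀ᶠ δ in 𝓝[>] (0 : ℝ), κ * (δ ^ (1 - α) * B) ≤ 1 / 2 :=
    (hlim.eventually_le_const one_half_pos).filter_mono nhdsWithin_le_nhds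
  obtain ⟨δ, hδ, hδ0⟩ := (hev.and self_mem_nhdsWithin).exists
  exact ⟨δ, hδ0, fun N p hN hp hle t ht =>
    le_of_le_add_integral_sub_rpow hα0 hα hκ hN hδ hp hle ht⟩

variable {E : Type*} [NormedAddCommGroup E] [NormedSpace ℝ E]

lemma norm_integral_Ioc_rpow_neg_smul_le {g : ℝ → E} {α t M : ℝ} (hα : α < 1) (ht : 0 < t)
    (hg : ∀ τ ∈ Ioc 0 t, ‖g τ‖ ≤ M / t) :
    ‖∫ τ in Ioc 0 t, τ ^ (-α) • g τ‖ ≤ M / (1 - α) * t ^ (-α) := by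
  have hmajorant : IntegrableOn (fun τ : ℝ => τ ^ (-α) * (M / t)) (Ioc 0 t) :=
    ((intervalIntegrable_iff_integrableOn_Ioc_of_le ht.le).1
      (intervalIntegral.intervalIntegrable_rpow' (by linarith))).mul_const _
  calc ‖∫ τ in Ioc 0 t, τ ^ (-α) • g τ‖ ≤ ∫ τ in Ioc 0 t, τ ^ (-α) * (M / t) := by
        refine norm_integral_le_of_norm_le hmajorant ?_
        refine (ae_restrict_iff' measurableSet_Ioc).2 (Eventually.of_forall fun τ hτ => ?_)
        have hτ0 : 0 < τ := hτ.1
        rw [norm_smul, Real.norm_of_nonneg (by positivity)]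
        gcongr
        exact hg τ hτ
    _ = M / (1 - α) * t ^ (-α) := by
        rw [integral_mul_const, ← intervalIntegral.integral_of_le ht.le,
          integral_rpow (Or.inl (by linarith)), Real.zero_rpow (by linarith), sub_zero,
          neg_add_eq_sub, Real.rpow_sub ht, Real.rpow_one, Real.rpow_neg ht.le]
        field_simp

lemma norm_integral_Ioi_rpow_neg_smul_le {g : ℝ → E} {α t M : ℝ} (hα : 0 < α) (ht : 0 < t)
    (hg : ∀ τ ∈ Ioi t, ‖g τ‖ ≤ M / τ) :
    ‖∫ τ in Ioi t, τ ^ (-α) • g τ‖ ≤ M / α * t ^ (-α) := by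
  have hmajorant : IntegrableOn (fun τ : ℝ => τ ^ (-α - 1) * M) (Ioi t) :=
    (integrableOn_Ioi_rpow_of_lt (by linarith) ht).mul_const _
  calc ‖∫ τ in Ioi t, τ ^ (-α) • g τ‖ ≤ ∫ τ in Ioi t, τ ^ (-α - 1) * M := by
        refine norm_integral_le_of_norm_le hmajorant ?_
        refine (ae_restrict_iff' measurableSet_Ioi).2 (Eventually.of_forall fun τ hτ => ?_)
        have hτ0 : 0 < τ := ht.trans hτ
        rw [norm_smul, Real.norm_of_nonneg (by positivity), Real.rpow_sub_one hτ0.ne',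
          div_mul_eq_mul_div, mul_div_assoc]
        gcongr
        exact hg τ hτ
    _ = M / α * t ^ (-α) := by
        rw [integral_mul_const, integral_Ioi_rpow_of_lt (by linarith) ht, sub_add_cancel]
        field_simp

lemma norm_integral_rpow_neg_smul_le {g : ℝ → E} {α t M : ℝ} (hα0 : 0 < α) (hα : α < 1)
    (ht : 0 < t) (hM : 0 ≤ M) (hint : IntegrableOn (fun τ => τ ^ (-α) • g τ) (Ioi 0))
    (hg : ∀ τ, 0 < τ → ‖g τ‖ ≤ M / (τ + t)) :
    ‖∫ τ in Ioi (0 : ℝ), τ ^ (-α) • g τ‖ ≤ (M / (1 - α) + M / α) * t ^ (-α) := by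
  rw [← Ioc_union_Ioi_eq_Ioi ht.le, setIntegral_union Ioc_disjoint_Ioi_same measurableSet_Ioi
    (hint.mono_set Ioc_subset_Ioi_self) (hint.mono_set (Ioi_subset_Ioi ht.le)), add_mul]
  refine norm_add_le_of_le (norm_integral_Ioc_rpow_neg_smul_le hα ht fun τ hτ => ?_)
    (norm_integral_Ioi_rpow_neg_smul_le hα0 ht fun τ hτ => ?_)
  · exact (hg τ hτ.1).trans (by gcongr; linarith [hτ.1])
  · have hτ0 : 0 < τ := ht.trans hτ
    exact (hg τ hτ0).trans (by gcongr; linarith)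

end Singular

lemma exists_factors_negPow {Z : Type*} [NormedAddCommGroup Z] [InnerProductSpace ℝ Z]
    [CompleteSpace Z] {T : C0Semigroup Z} (hT : T.ExpStable) (hA : T.IsAnalytic) {α : ℝ}
    (hα0 : 0 < α) (hα : α < 1) :
    ∃ (M : ℝ) (V : ℝ → Z →L[ℝ] Z), 0 < M ∧ Factors T (negPow T α) V fun t => M * t ^ (-α) := by
  obtain ⟨M, D, hM, hD⟩ := hA.exists_generator_op
  have h1α : 0 < 1 - α := sub_pos.2 hα
  refine ⟨(Real.Gamma (1 - α))⁻¹ * (M / (1 - α) + M / α), fun t => -(negPow T (1 - α)).comp (D t),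
    by positivity, negPow_injective hT hA hα0.le hα.le, fun t ht x => ?_, fun t ht => ?_⟩
  · rw [neg_apply, map_neg, ContinuousLinearMap.comp_apply, negPow_negPow hT hA hα0.le h1α.le,
      add_sub_cancel]
    exact ((mem_generatorGraph_iff hT hA).1 ((hD t ht).1 x)).symm
  rw [norm_neg]
  refine ContinuousLinearMap.opNorm_le_bound _ (by positivity) fun x => ?_
  have hop : ∀ τ, 0 < τ → ‖T.op τ (D t x)‖ ≤ M * ‖x‖ / (τ + t) := fun τ hτ => by
    have hadd : T.op τ (D t x) = D (τ + t) x := by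
      refine C0Semigroup.generatorGraph_unique
        (C0Semigroup.op_mem_generatorGraph ((hD t ht).1 x) hτ.le) ?_
      rw [← T.op_add_apply hτ.le ht.le]
      exact (hD _ (add_pos hτ ht)).1 x
    rw [hadd, mul_div_right_comm]
    exact (D (τ + t)).le_of_opNorm_le (hD _ (add_pos hτ ht)).2 x
  have hint := (C0Semigroup.integrableOn_rpow_smul_op hT hA h1α).apply_continuousLinearMap (D t x)
  simp only [smul_apply, sub_sub_cancel_left] at hint
  rw [ContinuousLinearMap.comp_apply, negPow_apply hT hA h1α, norm_smul,
    Real.norm_of_nonneg (by positivity), sub_sub_cancel_left]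
  calc (Real.Gamma (1 - α))⁻¹ * ‖∫ τ in Ioi (0 : ℝ), τ ^ (-α) • T.op τ (D t x)‖
      ≤ (Real.Gamma (1 - α))⁻¹ * ((M * ‖x‖ / (1 - α) + M * ‖x‖ / α) * t ^ (-α)) := by
        gcongr
        exact norm_integral_rpow_neg_smul_le hα0 hα ht (by positivity) hint hop
    _ = (Real.Gamma (1 - α))⁻¹ * (M / (1 - α) + M / α) * t ^ (-α) * ‖x‖ := by ring

section Extension

variable {E F : Type*} [NormedAddCommGroup E] [NormedSpace ℝ E]
  [NormedAddCommGroup F] [InnerProductSpace ℝ F] [CompleteSpace F] {J : F →L[ℝ] E}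

lemma exists_preimage_norm_le_of_dense {L : E →L[ℝ] E} {C : ℝ} (hC : 0 ≤ C) {s : Set E}
    (hs : Dense s) (h : ∀ y ∈ s, ∃ u, J u = L y ∧ ‖u‖ ≤ C * ‖y‖) (x : E) :
    ∃ u, J u = L x ∧ ‖u‖ ≤ C * ‖x‖ := by
  rw [← imageNorm_le_ofReal_iff (by positivity)]
  have hclosed : IsClosed {y | imageNorm J (L y) ≤ ENNReal.ofReal (C * ‖y‖)} :=
    (lowerSemicontinuous_imageNorm J).isClosed_epigraph.preimage
      (L.continuous.prodMk (ENNReal.continuous_ofReal.comp (by fun_prop)))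
  have hsub : s ⊆ {y | imageNorm J (L y) ≤ ENNReal.ofReal (C * ‖y‖)} := fun y hy =>
    (imageNorm_le_ofReal_iff (by positivity)).2 (h y hy)
  exact hclosed.closure_subset_iff.2 hsub (hs x)

end Extension

section ExtensionInTime

variable {E F : Type*} [NormedAddCommGroup E] [NormedSpace ℝ E]
  [NormedAddCommGroup F] [NormedSpace ℝ F] {J : F →L[ℝ] E} {S : C0Semigroup E}

lemma exists_lift_of_bound (hJ : Function.Injective J) {L : E →L[ℝ] E} {C : ℝ} (hC : 0 ≤ C)
    (h : ∀ x, ∃ u, J u = L x ∧ ‖u‖ ≤ C * ‖x‖) :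
    ∃ V : E →L[ℝ] F, (∀ x, J (V x) = L x) ∧ ‖V‖ ≤ C := by
  choose u hu hun using h
  let V : E →ₗ[ℝ] F :=
    { toFun := u
      map_add' := fun a b => hJ (by rw [map_add, hu, hu, hu, map_add])
      map_smul' := fun r a => hJ (by rw [map_smul, hu, hu, map_smul, RingHom.id_apply]) }
  exact ⟨V.mkContinuous C hun, hu, V.mkContinuous_norm_le hC hun⟩

/-- `S t = S (min t δ) S (t - min t δ)` extends the bound near `t = 0` to all times. -/
lemma C0Semigroup.ExpStable.exists_factors (hS : S.ExpStable) (hJ : Function.Injective J)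
    {K δ α : ℝ} (hK : 0 ≤ K) (hδ : 0 < δ) (hα : α < 1)
    (h : ∀ t ∈ Ioc 0 δ, ∀ x, ∃ u, J u = S.op t x ∧ ‖u‖ ≤ K * t ^ (-α) * ‖x‖) :
    ∃ W k, IntegrableOn k (Ioi 0) ∧ Factors S J W k := by
  obtain ⟨M, ω, -, hω, hM⟩ := hS
  set k : ℝ → ℝ := fun t => K * (t ^ (-α) + δ ^ (-α)) * (M * Real.exp (ω * δ) * Real.exp (-ω * t))
    with hk
  have hW (t : ℝ) : ∃ W : E →L[ℝ] F, 0 < t → (∀ x, J (W x) = S.op t x) ∧ ‖W‖ ≤ k t := by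
    obtain ht | ht := le_or_gt t 0
    · exact ⟨0, fun ht' => absurd ht' ht.not_gt⟩
    set r := min t δ
    have hr : r ∈ Ioc 0 δ := ⟨lt_min ht hδ, min_le_right _ _⟩
    have hr0 : 0 < r := hr.1
    have hrt : 0 ≤ t - r := sub_nonneg.2 (min_le_left _ _)
    obtain ⟨V, hV, hVn⟩ := exists_lift_of_bound hJ (by positivity) (h r hr)
    refine ⟨V.comp (S.op (t - r)), fun _ => ⟨fun x => ?_, ?_⟩⟩
    · rw [ContinuousLinearMap.comp_apply, hV, ← S.op_add_apply hr0.le hrt, add_sub_cancel]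
    have hrα : r ^ (-α) ≤ t ^ (-α) + δ ^ (-α) := by
      have : 0 ≤ t ^ (-α) := by positivity
      have : 0 ≤ δ ^ (-α) := by positivity
      obtain hr | hr := min_choice t δ <;> simp only [r, hr] <;> linarith
    calc ‖V.comp (S.op (t - r))‖ ≤ ‖V‖ * ‖S.op (t - r)‖ := ContinuousLinearMap.opNorm_comp_le _ _
      _ ≤ K * r ^ (-α) * (M * Real.exp (-ω * (t - r))) := by gcongr; exact hM _ hrt
      _ ≤ k t := by
          have hM0 : 0 ≤ M := by simpa using (norm_nonneg _).trans (hM 0 le_rfl)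
          have hexp : Real.exp (-ω * (t - r)) ≤ Real.exp (ω * δ) * Real.exp (-ω * t) := by
            rw [← Real.exp_add]
            gcongr
            nlinarith [hr.2]
          simp only [hk, mul_assoc M]
          gcongr
  choose W hW using hW
  refine ⟨W, k, ?_, hJ, fun t ht => (hW t ht).1, fun t ht => (hW t ht).2⟩
  have hrpow := integrableOn_rpow_mul_exp_neg_mul_rpow (s := -α) (p := 1) (by linarith) one_pos hω
  simp only [Real.rpow_one] at hrpow
  have hexp := integrableOn_exp_mul_Ioi (neg_neg_of_pos hω) 0
  refine ((hrpow.add (hexp.const_mul (δ ^ (-α)))).const_mul (K * (M * Real.exp (ω * δ)))).congr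
    (Eventually.of_forall fun t => ?_)
  simp only [hk, Pi.add_apply]
  ring

end ExtensionInTime

/-! ### Rank-one output feedback -/

section ShermanMorrison

variable {E : Type*} [NormedAddCommGroup E] [NormedSpace ℝ E] {b : E} {q : StrongDual ℝ E}

/-- The operator `A A_β⁻¹ = I + (1 - β) B C A⁻¹`, as in the Sherman–Morrison formula for
`A_β = A - (1 - β) / β B C`, with `C A⁻¹ = q` normalized by `q b = -1`. -/
def shermanMorrison (β : ℝ) (b : E) (q : StrongDual ℝ E) : E →L[ℝ] E :=
  ContinuousLinearMap.id ℝ E + (1 - β) • q.smulRight b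

lemma shermanMorrison_apply (β : ℝ) (b : E) (q : StrongDual ℝ E) (w : E) :
    shermanMorrison β b q w = w + ((1 - β) * q w) • b := by
  simp [shermanMorrison, mul_smul]

lemma apply_shermanMorrison (hq : q b = -1) (β : ℝ) (w : E) :
    q (shermanMorrison β b q w) = β * q w := by
  rw [shermanMorrison_apply, map_add, map_smul, hq, smul_eq_mul]
  ring

lemma eq_sub_smul_iff_eq_shermanMorrison (hq : q b = -1) (hβ : β ≠ 0)
    {v w : E} : w = v - ((1 - β) / β * q v) • b ↔ v = shermanMorrison β b q w := by
  rw [shermanMorrison_apply]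
  constructor <;> rintro rfl
  · rw [map_sub, map_smul, hq, sub_add, ← sub_smul, smul_eq_mul]
    convert (sub_zero v).symm
    rw [show (1 - β) / β * q v - (1 - β) * (q v - (1 - β) / β * q v * -1) = 0 by field_simp; ring,
      zero_smul]
  · rw [map_add, map_smul, hq, add_sub_assoc, ← sub_smul, smul_eq_mul]
    convert (add_zero w).symm
    rw [show (1 - β) * q w - (1 - β) / β * (q w + (1 - β) * q w * -1) = 0 by field_simp; ring,
      zero_smul]

end ShermanMorrison

section Feedback

variable {Z : Type*} [NormedAddCommGroup Z] [InnerProductSpace ℝ Z] [CompleteSpace Z]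
  {T S : C0Semigroup Z} {α β : ℝ} {b : Z} {c : StrongDual ℝ Z}

/-- The functional `C A⁻¹`, where `A` generates `T` and `C (-A)^{-α} = c`. -/
def outputInv (T : C0Semigroup Z) (α : ℝ) (c : StrongDual ℝ Z) : StrongDual ℝ Z :=
  -c.comp (negPow T (1 - α))

/-- `S` is the semigroup generated by `A_β = A - (1 - β) / β b C`, where `A` generates the analytic
semigroup `T`, the functional `C` is given by `C (-A)^{-α} = c`, and `C A⁻¹ b = -1`. -/
structure Feedback (T S : C0Semigroup Z) (α β : ℝ) (b : Z) (c : StrongDual ℝ Z) : Prop where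
  stable : T.ExpStable
  analytic : T.IsAnalytic
  stable_feedback : S.ExpStable
  α_pos : 0 < α
  α_lt : α < 1
  β_ne : β ≠ 0
  outputInv_b : outputInv T α c b = -1
  mem_graph : ∀ u w, (u, w) ∈ S.generatorGraph ↔
    (u, shermanMorrison β b (outputInv T α c) w) ∈ T.generatorGraph

namespace Feedback

lemma injective (h : Feedback T S α β b c) : Function.Injective (negPow T α) :=
  negPow_injective h.stable h.analytic h.α_pos.le h.α_lt.le

lemma negPow_of_mem_graph (h : Feedback T S α β b c) {u w : Z}
    (hu : (u, w) ∈ S.generatorGraph) :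
    negPow T α (-negPow T (1 - α) (shermanMorrison β b (outputInv T α c) w)) = u := by
  rw [map_neg, negPow_negPow h.stable h.analytic h.α_pos.le (sub_nonneg.2 h.α_lt.le),
    add_sub_cancel]
  exact ((mem_generatorGraph_iff h.stable h.analytic).1 ((h.mem_graph u w).1 hu)).symm

omit [CompleteSpace Z] in
lemma apply_neg_negPow (h : Feedback T S α β b c) (w : Z) :
    c (-negPow T (1 - α) (shermanMorrison β b (outputInv T α c) w)) = β * outputInv T α c w := by
  rw [map_neg]
  exact apply_shermanMorrison h.outputInv_b β w

lemma exists_orbit_lift (h : Feedback T S α β b c) {x w : Z} (hx : (x, w) ∈ S.generatorGraph) :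
    ∃ U : ℝ → Z, ContinuousOn U (Ici 0) ∧ ∀ t, 0 ≤ t → negPow T α (U t) = S.op t x ∧
      (S.op t x, S.op t w - ((β - 1) / β * c (U t)) • b) ∈ T.generatorGraph := by
  refine ⟨fun t => -negPow T (1 - α) (shermanMorrison β b (outputInv T α c) (S.op t w)), ?_,
    fun t ht => ?_⟩
  · exact (((negPow T (1 - α)).comp (shermanMorrison β b _)).continuous.comp_continuousOn
      (S.continuousOn w)).neg
  have hxt := C0Semigroup.op_mem_generatorGraph hx ht
  refine ⟨h.negPow_of_mem_graph hxt, ?_⟩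
  convert (h.mem_graph _ _).1 hxt using 2
  have hβ := h.β_ne
  rw [h.apply_neg_negPow, shermanMorrison_apply, sub_eq_add_neg, ← neg_smul]
  congr 2
  field_simp
  ring

lemma exists_orbit_lift_norm_le (h : Feedback T S α β b c) {V : ℝ → Z →L[ℝ] Z} {M : ℝ}
    (hV : Factors T (negPow T α) V fun t => M * t ^ (-α)) {x w : Z}
    (hx : (x, w) ∈ S.generatorGraph) :
    ∃ U : ℝ → Z, ContinuousOn U (Ici 0) ∧ ∀ t, 0 < t → negPow T α (U t) = S.op t x ∧
      ‖U t‖ ≤ M * ‖x‖ * t ^ (-α) +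
        |(β - 1) / β| * ‖c‖ * ‖b‖ * M * ∫ τ in (0 : ℝ)..t, (t - τ) ^ (-α) * ‖U τ‖ := by
  obtain ⟨U, hUcont, hU⟩ := h.exists_orbit_lift hx
  refine ⟨U, hUcont, fun t ht => ⟨(hU t ht.le).1, ?_⟩⟩
  set g : ℝ → Z := fun τ => ((β - 1) / β * c (U τ)) • b with hg
  have hgcont : ContinuousOn g (Ici 0) :=
    (continuousOn_const.mul (c.continuous.comp_continuousOn hUcont)).smul continuousOn_const
  have hgt : ContinuousOn g (Icc 0 t) := hgcont.mono Icc_subset_Ici_self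
  have hk : IntervalIntegrable (fun t : ℝ => M * t ^ (-α)) volume 0 (t - 0) :=
    (intervalIntegral.intervalIntegrable_rpow' (by linarith [h.α_lt])).const_mul M
  have hUt : U t = V t x + ∫ τ in (0 : ℝ)..t, V (t - τ) (g τ) := by
    refine h.injective ?_
    rw [map_add, hV.map_apply t ht, hV.map_integral_conv h.stable ht.le hk hgt, (hU t ht.le).1]
    exact h.stable.op_eq_add_integral hx hgcont (fun τ hτ => (hU τ hτ).2) ht.le
  have hgnorm (τ : ℝ) : ‖g τ‖ ≤ |(β - 1) / β| * (‖c‖ * ‖U τ‖) * ‖b‖ := by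
    rw [hg, norm_smul, norm_mul, Real.norm_eq_abs]
    gcongr
    exact c.le_opNorm _
  have hconv : ‖∫ τ in (0 : ℝ)..t, V (t - τ) (g τ)‖ ≤ ∫ τ in (0 : ℝ)..t,
      |(β - 1) / β| * ‖c‖ * ‖b‖ * M * ((t - τ) ^ (-α) * ‖U τ‖) := by
    refine intervalIntegral.norm_integral_le_of_norm_le ht.le ?_
      (((intervalIntegrable_sub_rpow_neg h.α_lt t).mul_continuousOn (by
        rw [uIcc_of_le ht.le]
        exact (hUcont.mono Icc_subset_Ici_self).norm)).const_mul _)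
    filter_upwards [volume.ae_ne t] with τ hne hτ
    have hτt : 0 < t - τ := sub_pos.2 (lt_of_le_of_ne hτ.2 hne)
    have hnonneg := (norm_nonneg _).trans (hV.norm_le _ hτt)
    calc ‖V (t - τ) (g τ)‖ ≤ M * (t - τ) ^ (-α) * ‖g τ‖ := hV.norm_apply_le hτt _
      _ ≤ M * (t - τ) ^ (-α) * (|(β - 1) / β| * (‖c‖ * ‖U τ‖) * ‖b‖) := by
          gcongr
          exact hgnorm τ
      _ = _ := by ring
  rw [intervalIntegral.integral_const_mul] at hconv
  rw [hUt]
  exact norm_add_le_of_le ((hV.norm_apply_le ht x).trans_eq (by ring)) hconv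

lemma exists_bound (h : Feedback T S α β b c) :
    ∃ K δ : ℝ, 0 ≤ K ∧ 0 < δ ∧ ∀ t ∈ Ioc 0 δ, ∀ x,
      ∃ u, negPow T α u = S.op t x ∧ ‖u‖ ≤ K * t ^ (-α) * ‖x‖ := by
  obtain ⟨M, V, hM, hV⟩ := exists_factors_negPow h.stable h.analytic h.α_pos h.α_lt
  obtain ⟨δ, hδ, hgronwall⟩ := exists_singular_gronwall (κ := |(β - 1) / β| * ‖c‖ * ‖b‖ * M)
    h.α_pos h.α_lt (by positivity)
  refine ⟨2 * M, δ, by positivity, hδ, fun t ht x => ?_⟩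
  have ht0 : 0 < t := ht.1
  refine exists_preimage_norm_le_of_dense (by positivity) S.dense_domain ?_ x
  rintro y ⟨w, hy⟩
  obtain ⟨U, hUcont, hU⟩ := h.exists_orbit_lift_norm_le hV hy
  refine ⟨U t, (hU t ht0).1, (hgronwall (M * ‖y‖) (fun t => ‖U t‖) (by positivity)
    (hUcont.mono Icc_subset_Ici_self).norm (fun τ hτ => (hU τ hτ.1).2) t ht).trans_eq ?_⟩
  ring

lemma exists_factors (h : Feedback T S α β b c) :
    ∃ W k, IntegrableOn k (Ioi 0) ∧ Factors S (negPow T α) W k := by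
  obtain ⟨K, δ, hK, hδ, hbound⟩ := h.exists_bound
  exact h.stable_feedback.exists_factors h.injective hK hδ h.α_lt hbound

lemma integral_factors (h : Feedback T S α β b c) {W : ℝ → Z →L[ℝ] Z} {k : ℝ → ℝ}
    (hW : Factors S (negPow T α) W k) (hk : IntegrableOn k (Ioi 0)) (x : Z) {t : ℝ} (ht : 0 ≤ t) :
    ∫ τ in (0 : ℝ)..t, c (W τ x) = β * outputInv T α c (S.op t x - x) := by
  have hint : IntervalIntegrable (fun τ => W τ x) volume 0 t :=
    (intervalIntegrable_iff_integrableOn_Ioc_of_le ht).2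
      ((hW.integrableOn_apply h.stable_feedback hk x).mono_set Ioc_subset_Ioi_self)
  have hmap : negPow T α (∫ τ in (0 : ℝ)..t, W τ x) = ∫ τ in (0 : ℝ)..t, S.op τ x := by
    rw [← (negPow T α).intervalIntegral_comp_comm hint, intervalIntegral.integral_of_le ht,
      intervalIntegral.integral_of_le ht]
    exact setIntegral_congr_fun measurableSet_Ioc fun τ hτ => hW.map_apply τ hτ.1 x
  rw [c.intervalIntegral_comp_comm hint, ← h.apply_neg_negPow]
  congr 1
  exact h.injective
    (hmap.trans (h.negPow_of_mem_graph (S.integral_mem_generatorGraph x ht)).symm)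

end Feedback
end Feedback

/-! ### The extrapolation space -/

section Extrapolation

variable {Z : Type*} [NormedAddCommGroup Z] [InnerProductSpace ℝ Z] [CompleteSpace Z]
  {T : C0Semigroup Z} {s : ℝ}

/-- The inclusion `Z ⊆ Z^{-s}` as a bounded operator. -/
def inclL (T : C0Semigroup Z) (s : ℝ) : Z →L[ℝ] NegSpace T s :=
  LinearMap.mkContinuous
    { toFun := incl T s
      map_add' := fun φ ψ => by
        rw [incl, incl, incl, map_add, UniformSpace.Completion.coe_add]
      map_smul' := fun r φ => by
        rw [incl, incl, map_smul, UniformSpace.Completion.coe_smul, RingHom.id_apply] }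
    ‖negPow T s‖ fun φ =>
      (UniformSpace.Completion.norm_coe (toPreNeg T s φ)).trans_le ((negPow T s).le_opNorm φ)

omit [CompleteSpace Z] in
@[simp] lemma inclL_apply (T : C0Semigroup Z) (s : ℝ) (φ : Z) : inclL T s φ = incl T s φ := rfl

omit [CompleteSpace Z] in
lemma norm_incl (T : C0Semigroup Z) (s : ℝ) (φ : Z) : ‖incl T s φ‖ = ‖negPow T s φ‖ :=
  UniformSpace.Completion.norm_coe _

omit [CompleteSpace Z] in
lemma denseRange_incl (T : C0Semigroup Z) (s : ℝ) : DenseRange (incl T s) :=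
  UniformSpace.Completion.denseRange_coe.comp (toPreNeg T s).surjective.denseRange
    (UniformSpace.Completion.continuous_coe _)

/-- The extension of `(-A)^{-s}` to an isometric isomorphism `Z^{-s} ≃ Z`. -/
def negIso (hT : T.ExpStable) (hA : T.IsAnalytic) (hs : 0 ≤ s) (hs1 : s ≤ 1) :
    NegSpace T s ≃ₗᵢ[ℝ] Z :=
  (LinearEquiv.refl ℝ Z).extendOfIsometry (inclL T s : Z →ₗ[ℝ] NegSpace T s)
    (negPow T s : Z →ₗ[ℝ] Z) (denseRange_incl T s) (denseRange_negPow hT hA hs hs1)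
    fun φ => (norm_incl T s φ).symm

section

variable (hT : T.ExpStable) (hA : T.IsAnalytic) (hs : 0 ≤ s) (hs1 : s ≤ 1)

lemma negIso_incl (φ : Z) : negIso hT hA hs hs1 (incl T s φ) = negPow T s φ :=
  LinearEquiv.extendOfIsometry_eq _ (inclL T s : Z →ₗ[ℝ] NegSpace T s) _ _ _ _ φ

include hT hA hs hs1 in
lemma incl_injective : Function.Injective (incl T s) := fun φ ψ h =>
  negPow_injective hT hA hs hs1 (by
    rw [← negIso_incl hT hA hs hs1, h, negIso_incl hT hA hs hs1])

lemma negIso_incl_neg_negPow_one (φ : Z) :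
    negIso hT hA hs hs1 (incl T s (-negPow T 1 φ)) =
      -negPow T 1 (negIso hT hA hs hs1 (incl T s φ)) := by
  rw [negIso_incl, negIso_incl, map_neg, negPow_negPow hT hA hs zero_le_one,
    negPow_negPow hT hA zero_le_one hs, add_comm]

lemma negIso_eq_of_mem_extGraph {x y : NegSpace T s} (h : (x, y) ∈ extGraph T s) :
    negIso hT hA hs hs1 x = -negPow T 1 (negIso hT hA hs hs1 y) := by
  set Λ := negIso hT hA hs hs1
  have hclosed : IsClosed {p : NegSpace T s × NegSpace T s | Λ p.1 = -negPow T 1 (Λ p.2)} :=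
    isClosed_eq (by fun_prop) (by fun_prop)
  refine hclosed.closure_subset_iff.2 ?_ h
  rintro _ ⟨⟨φ, ψ⟩, hφ, rfl⟩
  obtain rfl := (mem_generatorGraph_iff hT hA).1 hφ
  exact negIso_incl_neg_negPow_one hT hA hs hs1 ψ

lemma symm_neg_negPow_mem_extGraph (y : NegSpace T s) :
    ((negIso hT hA hs hs1).symm (-negPow T 1 (negIso hT hA hs hs1 y)), y) ∈ extGraph T s := by
  set Λ := negIso hT hA hs hs1
  refine (denseRange_incl T s).induction_on
    (p := fun y => (Λ.symm (-negPow T 1 (Λ y)), y) ∈ extGraph T s) y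
    (isClosed_closure.preimage (by fun_prop)) fun ψ => subset_closure
      ⟨(-negPow T 1 ψ, ψ), (mem_generatorGraph_iff hT hA).2 rfl, Prod.ext ?_ rfl⟩
  change incl T s (-negPow T 1 ψ) = Λ.symm (-negPow T 1 (Λ (incl T s ψ)))
  rw [Λ.eq_symm_apply]
  exact negIso_incl_neg_negPow_one hT hA hs hs1 ψ

lemma mem_extGraph_iff {x y : NegSpace T s} : (x, y) ∈ extGraph T s ↔
    negIso hT hA hs hs1 x = -negPow T 1 (negIso hT hA hs hs1 y) := by
  refine ⟨negIso_eq_of_mem_extGraph hT hA hs hs1, fun h => ?_⟩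
  rw [← (negIso hT hA hs hs1).symm_apply_apply x, h]
  exact symm_neg_negPow_mem_extGraph hT hA hs hs1 y

end

lemma graphInv_eq {X : Type*} [Zero X] {L : Set (X × X)} {x y : X} (h : (y, x) ∈ L)
    (huniq : ∀ y', (y', x) ∈ L → y' = y) : graphInv L x = y := by
  have hex : ∃ y : X, (y, x) ∈ L := ⟨y, h⟩
  rw [graphInv, dif_pos hex]
  exact huniq _ hex.choose_spec

end Extrapolation

namespace C0Semigroup

variable {E F : Type*} [NormedAddCommGroup E] [NormedSpace ℝ E] [NormedAddCommGroup F]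
  [NormedSpace ℝ F]

/-- The semigroup `Λ S(t) Λ⁻¹` obtained by transport along an isometric isomorphism `Λ`. -/
def conj (S : C0Semigroup E) (Λ : E ≃ₗᵢ[ℝ] F) : C0Semigroup F where
  op t := (Λ : E →L[ℝ] F).comp ((S.op t).comp (Λ.symm : F →L[ℝ] E))
  op_zero := by ext x; simp [S.op_zero]
  op_add s t hs ht := by ext x; simp [S.op_add s t hs ht]
  continuousOn x := Λ.continuous.comp_continuousOn (S.continuousOn (Λ.symm x))

variable {S : C0Semigroup E} (Λ : E ≃ₗᵢ[ℝ] F)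

lemma conj_op_apply (t : ℝ) (x : F) : (S.conj Λ).op t x = Λ (S.op t (Λ.symm x)) := rfl

lemma mem_generatorGraph_conj {u w : F} :
    (u, w) ∈ (S.conj Λ).generatorGraph ↔ (Λ.symm u, Λ.symm w) ∈ S.generatorGraph := by
  simp only [generatorGraph, mem_ofPred_eq, conj_op_apply]
  rw [Λ.symm.toHomeomorph.isInducing.tendsto_nhds_iff]
  simp [Function.comp_def]

lemma ExpStable.conj (h : S.ExpStable) : (S.conj Λ).ExpStable := by
  obtain ⟨M, ω, hM, hω, hb⟩ := h
  refine ⟨M, ω, hM, hω, fun t ht => ?_⟩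
  rw [C0Semigroup.conj, ContinuousLinearMap.opNorm_linearIsometryEquiv_comp,
    ContinuousLinearMap.opNorm_comp_linearIsometryEquiv]
  exact hb t ht

end C0Semigroup

lemma Factors.of_conj {E F G : Type*} [NormedAddCommGroup E] [NormedSpace ℝ E]
    [NormedAddCommGroup F] [NormedSpace ℝ F] [NormedAddCommGroup G] [NormedSpace ℝ G]
    {S : C0Semigroup E} {Λ : E ≃ₗᵢ[ℝ] F} {J : G →L[ℝ] F} {W : ℝ → F →L[ℝ] G} {k : ℝ → ℝ}
    (h : Factors (S.conj Λ) J W k) :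
    Factors S ((Λ.symm : F →L[ℝ] E).comp J) (fun t => (W t).comp (Λ : E →L[ℝ] F)) k where
  injective := Λ.symm.injective.comp h.injective
  map_apply t ht x := by
    change Λ.symm (J (W t (Λ x))) = _
    rw [h.map_apply t ht, C0Semigroup.conj_op_apply, Λ.symm_apply_apply, Λ.symm_apply_apply]
  norm_le t ht := (ContinuousLinearMap.opNorm_comp_linearIsometryEquiv _ Λ).trans_le
    (h.norm_le t ht)

/-! ### The output of the closed loop semigroup -/

namespace Plant

variable {Z : Type*} [NormedAddCommGroup Z] [InnerProductSpace ℝ Z] [CompleteSpace Z]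
  {P : Plant Z} {S : C0Semigroup P.X}

/-- The setting of the bounds: an exponentially stable analytic plant whose input and disturbance
are compatible with `C`, with any exponent `s₁ ≥ 0` and any `β ≠ 0`. -/
structure IsWellPosed (P : Plant Z) : Prop where
  stable : P.T.ExpStable
  analytic : P.T.IsAnalytic
  sb_nonneg : 0 ≤ P.sb
  sd_nonneg : 0 ≤ P.sd
  sc_nonneg : 0 ≤ P.sc
  scb : P.sc + P.sb < 1
  scd : P.sc + P.sd < 1
  /-- `C` is bounded for the norm of `Z^{s_c}`. -/
  C_bounded : ∃ M : ℝ, ∀ v : Z,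
    |P.C ⟨negPow P.T P.sc v, LinearMap.mem_range.2 ⟨v, rfl⟩⟩| ≤ M * ‖v‖
  gain_ne : P.gain ≠ 0
  s1_nonneg : 0 ≤ P.s1
  ε_pos : 0 < P.ε
  f_lipschitz : ∀ φ₁ φ₂ : Z,
    ‖P.f φ₁ - P.f φ₂‖ₑ ≤ ENNReal.ofReal P.ε * posNorm P.T P.s1 (φ₁ - φ₂)
  β_ne : P.β ≠ 0

lemma Assumptions.isWellPosed (hP : P.Assumptions) : P.IsWellPosed where
  stable := hP.stable
  analytic := hP.analytic
  sb_nonneg := hP.sb_nonneg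
  sd_nonneg := hP.sd_nonneg
  sc_nonneg := hP.sc_nonneg
  scb := hP.scb
  scd := hP.scd
  C_bounded := hP.C_bounded
  gain_ne := hP.gain_ne
  s1_nonneg := hP.s1_pos.le
  ε_pos := hP.ε_pos
  f_lipschitz := hP.f_lipschitz
  β_ne := hP.β_pos.ne'

namespace IsWellPosed

lemma s_nonneg (hP : P.IsWellPosed) : 0 ≤ max P.sb P.sd := le_max_of_le_left hP.sb_nonneg

lemma sc_add_s_lt (hP : P.IsWellPosed) : P.sc + max P.sb P.sd < 1 := by
  rw [← max_add_add_left]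
  exact max_lt hP.scb hP.scd

lemma s_le_one (hP : P.IsWellPosed) : max P.sb P.sd ≤ 1 := by
  linarith [hP.sc_add_s_lt, hP.sc_nonneg]

lemma ι_injective (hP : P.IsWellPosed) : Function.Injective P.ι :=
  incl_injective hP.stable hP.analytic hP.s_nonneg hP.s_le_one

/-- The isometric isomorphism `(-A)^{-s} : X ≃ Z`. -/
def Λ (hP : P.IsWellPosed) : P.X ≃ₗᵢ[ℝ] Z :=
  negIso hP.stable hP.analytic hP.s_nonneg hP.s_le_one

lemma Λ_ι (hP : P.IsWellPosed) (φ : Z) : hP.Λ (P.ι φ) = negPow P.T (max P.sb P.sd) φ :=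
  negIso_incl ..

/-- The functional `C (-A)^{-s_c}` on `Z`. -/
def outBase (hP : P.IsWellPosed) : StrongDual ℝ Z :=
  LinearMap.mkContinuousOfExistsBound
    (P.C ∘ₗ (negPow P.T P.sc : Z →ₗ[ℝ] Z).rangeRestrict) hP.C_bounded

lemma out_ι_negPow (hP : P.IsWellPosed) (v : Z) :
    P.out (P.ι (negPow P.T P.sc v)) = hP.outBase v := by
  have hex : ∃ φ : posSpace P.T P.sc, P.ι (φ : Z) = P.ι (negPow P.T P.sc v) :=
    ⟨⟨negPow P.T P.sc v, LinearMap.mem_range.2 ⟨v, rfl⟩⟩, rfl⟩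
  rw [out, dif_pos hex]
  exact congrArg P.C (Subtype.ext (hP.ι_injective hex.choose_spec))

/-- The functional `C (-A)^{s - α}` on `Z`, that is, `C Λ⁻¹ (-A)^{-α}`, for `α ≥ s_c + s`. -/
def outFrac (hP : P.IsWellPosed) (α : ℝ) : StrongDual ℝ Z :=
  hP.outBase.comp (negPow P.T (α - (P.sc + max P.sb P.sd)))

lemma out_symm_negPow (hP : P.IsWellPosed) {α : ℝ} (hα : P.sc + max P.sb P.sd ≤ α) (u : Z) :
    P.out (hP.Λ.symm (negPow P.T α u)) = hP.outFrac α u := by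
  have hfactor : hP.Λ.symm (negPow P.T α u) =
      P.ι (negPow P.T P.sc (negPow P.T (α - (P.sc + max P.sb P.sd)) u)) := by
    rw [hP.Λ.symm_apply_eq, hP.Λ_ι,
      negPow_negPow hP.stable hP.analytic hP.sc_nonneg (sub_nonneg.2 hα),
      negPow_negPow hP.stable hP.analytic hP.s_nonneg (by linarith [hP.sc_nonneg])]
    congr 2
    ring
  rw [hfactor, hP.out_ι_negPow]
  rfl

/-- The functional `C A⁻¹` on `X`. -/
def outAinv (hP : P.IsWellPosed) : StrongDual ℝ P.X :=
  -(hP.outFrac 1).comp (hP.Λ : P.X →L[ℝ] Z)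

lemma outputInv_outFrac (hP : P.IsWellPosed) {α : ℝ} (hα : P.sc + max P.sb P.sd ≤ α)
    (hα1 : α ≤ 1) : outputInv P.T α (hP.outFrac α) = -hP.outFrac 1 := by
  ext v
  refine congrArg (fun w => -hP.outBase w) ?_
  refine (negPow_negPow hP.stable hP.analytic (sub_nonneg.2 hα) (sub_nonneg.2 hα1) v).trans ?_
  rw [add_comm, sub_add_sub_cancel]
  rfl

lemma mem_extGraph_iff (hP : P.IsWellPosed) {x y : P.X} :
    (x, y) ∈ extGraph P.T (max P.sb P.sd) ↔ hP.Λ x = -negPow P.T 1 (hP.Λ y) :=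
  GeomReg.mem_extGraph_iff ..

lemma out_of_mem_extGraph (hP : P.IsWellPosed) {x y : P.X}
    (h : (x, y) ∈ extGraph P.T (max P.sb P.sd)) : P.out x = hP.outAinv y := by
  rw [← hP.Λ.symm_apply_apply x, hP.mem_extGraph_iff.1 h, ← map_neg,
    hP.out_symm_negPow hP.sc_add_s_lt.le, map_neg]
  rfl

lemma Ainv_mem_extGraph (hP : P.IsWellPosed) (x : P.X) :
    (P.Ainv x, x) ∈ extGraph P.T (max P.sb P.sd) := by
  have hmem : (hP.Λ.symm (-negPow P.T 1 (hP.Λ x)), x) ∈ extGraph P.T (max P.sb P.sd) :=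
    hP.mem_extGraph_iff.2 (hP.Λ.apply_symm_apply _)
  rwa [Ainv, graphInv_eq hmem fun y hy => hP.Λ.eq_symm_apply.2 (hP.mem_extGraph_iff.1 hy)]

lemma out_Ainv (hP : P.IsWellPosed) (x : P.X) : P.out (P.Ainv x) = hP.outAinv x :=
  hP.out_of_mem_extGraph (hP.Ainv_mem_extGraph x)

lemma outAinv_B (hP : P.IsWellPosed) : hP.outAinv P.B = -1 := by
  have hneg : (-P.Ainv P.bInX, -P.bInX) ∈ extGraph P.T (max P.sb P.sd) := by
    rw [hP.mem_extGraph_iff, map_neg, map_neg, map_neg,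
      hP.mem_extGraph_iff.1 (hP.Ainv_mem_extGraph P.bInX)]
  have hgain : hP.outAinv P.bInX = -P.gain := by
    rw [gain, hP.out_of_mem_extGraph hneg, map_neg, neg_neg]
  rw [B, map_smul, hgain, smul_neg, smul_eq_mul, inv_mul_cancel₀ hP.gain_ne]

lemma mem_AβGraph_iff (hP : P.IsWellPosed) {x y : P.X} : (x, y) ∈ P.AβGraph ↔
    (x, shermanMorrison P.β P.B hP.outAinv y) ∈ extGraph P.T (max P.sb P.sd) := by
  constructor
  · rintro ⟨w, hw, hy⟩
    rw [hP.out_of_mem_extGraph hw] at hy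
    rwa [← (eq_sub_smul_iff_eq_shermanMorrison hP.outAinv_B hP.β_ne).1 hy]
  · refine fun h => ⟨_, h, ?_⟩
    rw [hP.out_of_mem_extGraph h]
    exact (eq_sub_smul_iff_eq_shermanMorrison hP.outAinv_B hP.β_ne).2 rfl

lemma out_Aβinv (hP : P.IsWellPosed) (x : P.X) : P.out (P.Aβinv x) = P.β * hP.outAinv x := by
  have hinv : P.Aβinv x = P.Ainv (shermanMorrison P.β P.B hP.outAinv x) :=
    graphInv_eq (hP.mem_AβGraph_iff.2 (hP.Ainv_mem_extGraph _)) fun y hy =>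
      hP.Λ.injective ((hP.mem_extGraph_iff.1 (hP.mem_AβGraph_iff.1 hy)).trans
        (hP.mem_extGraph_iff.1 (hP.Ainv_mem_extGraph _)).symm)
  rw [hinv, hP.out_Ainv, apply_shermanMorrison hP.outAinv_B]

/-- `I_0 = I + B C A⁻¹` as a bounded operator on `X`. -/
def I0L (hP : P.IsWellPosed) : P.X →L[ℝ] P.X :=
  ContinuousLinearMap.id ℝ P.X + hP.outAinv.smulRight P.B

lemma I0_eq (hP : P.IsWellPosed) (x : P.X) : P.I0 x = hP.I0L x := by
  rw [I0, hP.out_Ainv]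
  rfl

lemma Λ_shermanMorrison (hP : P.IsWellPosed) (y : P.X) :
    hP.Λ (shermanMorrison P.β P.B hP.outAinv y) =
      shermanMorrison P.β (hP.Λ P.B) (-hP.outFrac 1) (hP.Λ y) := by
  rw [shermanMorrison_apply, shermanMorrison_apply, map_add, map_smul]
  rfl

lemma feedback (hP : P.IsWellPosed) (hS : S.generatorGraph = P.AβGraph) (hSs : S.ExpStable)
    {α : ℝ} (hα : P.sc + max P.sb P.sd < α) (hα1 : α < 1) :
    Feedback P.T (S.conj hP.Λ) α P.β (hP.Λ P.B) (hP.outFrac α) where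
  stable := hP.stable
  analytic := hP.analytic
  stable_feedback := hSs.conj hP.Λ
  α_pos := (add_nonneg hP.sc_nonneg hP.s_nonneg).trans_lt hα
  α_lt := hα1
  β_ne := hP.β_ne
  outputInv_b := by
    rw [hP.outputInv_outFrac hα.le hα1.le]
    exact hP.outAinv_B
  mem_graph u w := by
    rw [C0Semigroup.mem_generatorGraph_conj, hS, hP.mem_AβGraph_iff, hP.mem_extGraph_iff,
      hP.Λ_shermanMorrison, hP.Λ.apply_symm_apply, hP.Λ.apply_symm_apply,
      hP.outputInv_outFrac hα.le hα1.le, mem_generatorGraph_iff hP.stable hP.analytic]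

end IsWellPosed

end Plant

/-! ### Convolutions -/

section Convolution

variable {g u : ℝ → ℝ≥0∞} {a : ℝ} {C : ℝ≥0∞}

lemma setLIntegral_comp_sub_left (g : ℝ → ℝ≥0∞) (t : ℝ) (s : Set ℝ) :
    ∫⁻ τ in (fun τ => t - τ) ⁻¹' s, g (t - τ) = ∫⁻ τ in s, g τ :=
  (volume.measurePreserving_sub_left t).setLIntegral_comp_preimage_emb
    (MeasurableEquiv.subLeft t).measurableEmbedding g s

lemma setLIntegral_Ioo_conv_le (hC : C ≠ ∞) {t : ℝ} (hu : ∀ τ ∈ Ioo a t, u τ ≤ C) :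
    ∫⁻ τ in Ioo a t, g (t - τ) * u τ ≤ (∫⁻ τ in Ioo 0 (t - a), g τ) * C := by
  rw [← setLIntegral_comp_sub_left g t, ← lintegral_mul_const' _ _ hC]
  simp only [preimage_const_sub_Ioo, sub_zero, sub_sub_cancel]
  exact setLIntegral_mono' measurableSet_Ioo fun τ hτ => mul_le_mul_right (hu τ hτ) _

lemma tendsto_setLIntegral_Ioi (hg : ∫⁻ τ in Ioi (0 : ℝ), g τ ≠ ∞) :
    Tendsto (fun a => ∫⁻ τ in Ioi a, g τ) atTop (𝓝 0) := by
  have h := tendsto_measure_iInter_atTop (μ := volume.withDensity g) (s := fun a : ℝ => Ioi a)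
    (fun a => measurableSet_Ioi.nullMeasurableSet) (fun a b hab => Ioi_subset_Ioi hab)
    ⟨0, by rwa [withDensity_apply _ measurableSet_Ioi]⟩
  have hempty : ⋂ a : ℝ, Ioi a = ∅ := iInter_eq_empty_iff.2 fun x => ⟨x, lt_irrefl x⟩
  rw [hempty, measure_empty] at h
  exact h.congr fun a => withDensity_apply _ measurableSet_Ioi

lemma tendsto_setLIntegral_Ioc_conv (hg : ∫⁻ τ in Ioi (0 : ℝ), g τ ≠ ∞) {b : ℝ} (hC : C ≠ ∞)
    (hu : ∀ τ ∈ Ioc a b, u τ ≤ C) :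
    Tendsto (fun t => ∫⁻ τ in Ioc a b, g (t - τ) * u τ) atTop (𝓝 0) := by
  have hshift : Tendsto (fun t : ℝ => t - b - 1) atTop atTop := by
    simpa only [sub_eq_add_neg, add_assoc, id] using
      tendsto_atTop_add_const_right atTop (-b + -1) tendsto_id
  have htail := ENNReal.Tendsto.mul_const (b := C) ((tendsto_setLIntegral_Ioi hg).comp hshift)
    (Or.inr hC)
  rw [zero_mul] at htail
  refine tendsto_of_tendsto_of_tendsto_of_le_of_le tendsto_const_nhds htail (fun _ => zero_le)
    fun t => ?_
  calc ∫⁻ τ in Ioc a b, g (t - τ) * u τ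
      ≤ ∫⁻ τ in Ioc a b, g (t - τ) * C :=
        setLIntegral_mono' measurableSet_Ioc fun τ hτ => mul_le_mul_right (hu τ hτ) _
    _ ≤ ∫⁻ τ in (fun τ => t - τ) ⁻¹' Ioi (t - b - 1), g (t - τ) * C :=
        lintegral_mono_set fun τ hτ => by
          simp only [mem_preimage, mem_Ioi]
          linarith [hτ.2]
    _ = (∫⁻ τ in Ioi (t - b - 1), g τ) * C := by
        rw [lintegral_mul_const' _ _ hC, setLIntegral_comp_sub_left]

lemma limsup_add_le_add {α : Type*} {l : Filter α} (u v : α → ℝ≥0∞) :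
    limsup (fun x => u x + v x) l ≤ limsup u l + limsup v l := by
  refine ENNReal.le_of_forall_pos_le_add fun η hη hfin => ?_
  have hη2 : ((η / 2 : NNReal) : ℝ≥0∞) ≠ 0 := ENNReal.coe_ne_zero.2 (half_pos hη).ne'
  obtain ⟨hU, hV⟩ := ENNReal.add_lt_top.1 hfin
  refine limsup_le_of_le (by isBoundedDefault) ?_
  filter_upwards [eventually_lt_of_limsup_lt (ENNReal.lt_add_right hU.ne hη2),
    eventually_lt_of_limsup_lt (ENNReal.lt_add_right hV.ne hη2)] with x hux hvx
  calc u x + v x ≤ (limsup u l + (η / 2 : NNReal)) + (limsup v l + (η / 2 : NNReal)) :=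
        add_le_add hux.le hvx.le
    _ = limsup u l + limsup v l + η := by
        rw [add_add_add_comm, ← ENNReal.coe_add, add_halves]

lemma limsup_conv_le_mul_of_eventually_le (hg : ∫⁻ τ in Ioi (0 : ℝ), g τ ≠ ∞) (hC : C ≠ ∞)
    (hu : ∀ τ, a < τ → u τ ≤ C) {L : ℝ≥0∞} (hL : L ≠ ∞) (hev : ∀ᶠ τ in atTop, u τ ≤ L) :
    limsup (fun t => ∫⁻ τ in Ioo a t, g (t - τ) * u τ) atTop ≤
      (∫⁻ τ in Ioi (0 : ℝ), g τ) * L := by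
  obtain ⟨b, hb⟩ := eventually_atTop.1 hev
  have hhead := tendsto_setLIntegral_Ioc_conv (b := b) hg hC fun τ hτ => hu τ hτ.1
  have hsplit : ∀ t, ∫⁻ τ in Ioo a t, g (t - τ) * u τ ≤
      (∫⁻ τ in Ioc a b, g (t - τ) * u τ) + (∫⁻ τ in Ioi (0 : ℝ), g τ) * L := by
    intro t
    have hsub : Ioo a t ⊆ Ioc a b ∪ Ioo b t := fun τ hτ =>
      (le_or_gt τ b).imp (fun h => ⟨hτ.1, h⟩) fun h => ⟨h, hτ.2⟩
    refine (lintegral_mono_set hsub).trans ((lintegral_union_le _ _ _).trans ?_)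
    gcongr
    refine (setLIntegral_Ioo_conv_le hL fun τ hτ => hb τ hτ.1.le).trans ?_
    gcongr
    exact Ioo_subset_Ioi_self
  refine (limsup_le_limsup (Eventually.of_forall hsplit)).trans ?_
  refine (limsup_add_le_add _ _).trans ?_
  rw [hhead.limsup_eq, zero_add, limsup_const]

lemma limsup_conv_le (hg : ∫⁻ τ in Ioi (0 : ℝ), g τ ≠ ∞) (hC : C ≠ ∞)
    (hu : ∀ τ, a < τ → u τ ≤ C) :
    limsup (fun t => ∫⁻ τ in Ioo a t, g (t - τ) * u τ) atTop ≤
      (∫⁻ τ in Ioi (0 : ℝ), g τ) * limsup u atTop := by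
  have hLC : limsup u atTop ≤ C :=
    limsup_le_of_le (by isBoundedDefault) (eventually_of_mem (Ioi_mem_atTop a) hu)
  refine ENNReal.le_mul_of_forall_lt (Or.inr (ne_top_of_le_ne_top hC hLC)) (Or.inl hg)
    fun I hI L hL => ?_
  rcases eq_or_ne L ∞ with rfl | hLt
  · rw [ENNReal.mul_top (pos_of_gt hI).ne']
    exact le_top
  · exact (limsup_conv_le_mul_of_eventually_le hg hC hu hLt
      ((eventually_lt_of_limsup_lt hL).mono fun _ => le_of_lt)).trans (mul_le_mul_left hI.le _)

lemma le_div_one_sub_of_le_mul_add {m q c : ℝ≥0∞} (hm : m ≠ ∞) (hq : q < 1)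
    (h : m ≤ m * q + c) : m ≤ c / (1 - q) := by
  rw [ENNReal.le_div_iff_mul_le (Or.inl (tsub_pos_of_lt hq).ne')
    (Or.inl (ENNReal.sub_ne_top ENNReal.one_ne_top)), ENNReal.mul_sub fun _ _ => hm, mul_one,
    tsub_le_iff_left]
  exact h

end Convolution

section IntegrationByParts

lemma intervalIntegrable_deriv_of_bound {e : ℝ → ℝ} {a t C : ℝ} (hat : a ≤ t)
    (hC : ∀ τ ∈ Ioo a t, ‖deriv e τ‖ ≤ C) : IntervalIntegrable (deriv e) volume a t := by
  refine (intervalIntegrable_const (c := C)).mono_fun' (measurable_deriv e).aestronglyMeasurable ?_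
  rw [uIoc_of_le hat, ← restrict_Ioo_eq_restrict_Ioc]
  exact (ae_restrict_iff' measurableSet_Ioo).2 (Eventually.of_forall hC)

lemma integral_conv_parts {K K' e e' : ℝ → ℝ} {a t : ℝ} (hat : a ≤ t)
    (hK : ContinuousOn K (Icc 0 (t - a))) (hKd : ∀ x ∈ Ioo 0 (t - a), HasDerivAt K (K' x) x)
    (hK' : IntervalIntegrable K' volume 0 (t - a)) (he : ContinuousOn e (Icc a t))
    (hed : ∀ τ ∈ Ioo a t, HasDerivAt e (e' τ) τ) (he' : IntervalIntegrable e' volume a t) :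
    ∫ τ in a..t, K (t - τ) * e' τ =
      K 0 * e t - K (t - a) * e a + ∫ τ in a..t, K' (t - τ) * e τ := by
  have hrefl : IntervalIntegrable (fun τ => -K' (t - τ)) volume a t := by
    have h := (hK'.comp_sub_left t).symm
    rw [sub_zero, sub_sub_cancel] at h
    exact h.neg
  have hKr : ContinuousOn (fun τ => K (t - τ)) (uIcc a t) := by
    rw [uIcc_of_le hat]
    exact hK.comp (continuousOn_const.sub continuousOn_id) fun τ hτ =>
      ⟨sub_nonneg.2 hτ.2, sub_le_sub_left hτ.1 t⟩
  rw [← uIcc_of_le hat] at he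
  have h := intervalIntegral.integral_mul_deriv_eq_deriv_mul_of_hasDerivAt hKr he
    (fun τ hτ => by
      rw [min_eq_left hat, max_eq_right hat] at hτ
      exact (hKd (t - τ) ⟨sub_pos.2 hτ.2, sub_lt_sub_left hτ.1 t⟩).comp_const_sub t τ)
    (fun τ hτ => hed τ (by rwa [min_eq_left hat, max_eq_right hat] at hτ)) hrefl he'
  simp only [sub_self, neg_mul, intervalIntegral.integral_neg, sub_neg_eq_add] at h
  exact h

end IntegrationByParts

/-! ### The kernels of the closed loop -/

lemma C0Semigroup.ExpStable.integrableOn_apply {E : Type*} [NormedAddCommGroup E]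
    [NormedSpace ℝ E] {S : C0Semigroup E} (hS : S.ExpStable) (q : StrongDual ℝ E) (x : E) :
    IntegrableOn (fun t => q (S.op t x)) (Ioi 0) := by
  obtain ⟨M, ω, -, hω, hM⟩ := hS
  refine Integrable.mono' ((integrableOn_exp_mul_Ioi (neg_lt_zero.2 hω) 0).const_mul
    (‖q‖ * M * ‖x‖)) (((q.continuous.comp_continuousOn (S.continuousOn x)).mono
      Ioi_subset_Ici_self).aestronglyMeasurable measurableSet_Ioi) ?_
  refine (ae_restrict_iff' measurableSet_Ioi).2 (Eventually.of_forall fun t ht => ?_)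
  calc ‖q (S.op t x)‖ ≤ ‖q‖ * (M * Real.exp (-ω * t) * ‖x‖) :=
        (q.le_opNorm _).trans (mul_le_mul_of_nonneg_left
          ((S.op t).le_of_opNorm_le (hM t (le_of_lt ht)) x) (norm_nonneg q))
    _ = ‖q‖ * M * ‖x‖ * Real.exp (-ω * t) := by ring

namespace Plant

variable {Z : Type*} [NormedAddCommGroup Z] [InnerProductSpace ℝ Z] [CompleteSpace Z]
  {P : Plant Z} {S : C0Semigroup P.X}

/-- The output map of the closed loop semigroup `S t = e^{A_β t}`, in factored form: `S t = R W(t)`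
for `t > 0`, where `R : Z → X` plays the role of `(-A)^{-α}` with `s_c + s < α < 1`, the functional
`C R = c` is bounded on `Z`, and `‖W(t)‖ ≤ k(t)` with `k` integrable. -/
structure OutputFactors (hP : P.IsWellPosed) (S : C0Semigroup P.X) (R : Z →L[ℝ] P.X)
    (W : ℝ → P.X →L[ℝ] Z) (k : ℝ → ℝ) (c : StrongDual ℝ Z) : Prop extends Factors S R W k where
  stable : S.ExpStable
  integrable : IntegrableOn k (Ioi 0)
  out_map : ∀ u, P.out (R u) = c u
  integral_eq : ∀ x t, 0 ≤ t →
    ∫ τ in (0 : ℝ)..t, c (W τ x) = P.β * (hP.outAinv (S.op t x) - hP.outAinv x)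

lemma IsWellPosed.exists_outputFactors (hP : P.IsWellPosed)
    (hS : S.generatorGraph = P.AβGraph) (hSs : S.ExpStable) :
    ∃ R W k c, OutputFactors hP S R W k c := by
  obtain ⟨α, hα, hα1⟩ := exists_between hP.sc_add_s_lt
  have hfb := hP.feedback hS hSs hα hα1
  obtain ⟨W, k, hk, hW⟩ := hfb.exists_factors
  refine ⟨_, _, k, hP.outFrac α, { hW.of_conj with
    stable := hSs
    integrable := hk
    out_map := hP.out_symm_negPow hα.le
    integral_eq := fun x t ht => ?_ }⟩
  have h := hfb.integral_factors hW hk (hP.Λ x) ht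
  rw [hP.outputInv_outFrac hα.le hα1.le, C0Semigroup.conj_op_apply,
    hP.Λ.symm_apply_apply, ← map_sub] at h
  rw [← map_sub]
  exact h

/-- The norm of the functional `C e^{A_β t} I_0` on `Z`, the integrand of `D_H`. -/
def outNorm (S : C0Semigroup P.X) (t : ℝ) : ℝ≥0∞ :=
  ⨆ (φ : Z) (_ : ‖φ‖ ≤ 1), ‖P.out (S.op t (P.I0 (P.ι φ)))‖ₑ

/-- The norm of `e^{A_β t} I_0 : Z → Z^{s₁}`, the integrand of `D_{A_β}`. -/
def stateNorm (S : C0Semigroup P.X) (t : ℝ) : ℝ≥0∞ :=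
  ⨆ (φ : Z) (_ : ‖φ‖ ≤ 1), posNormNeg P.T (max P.sb P.sd) P.s1 (S.op t (P.I0 (P.ι φ)))

/-- The norm of `β⁻¹ e^{A_β t} B` in `Z^{s₁}`, the integrand of `D_B`. -/
def inputNorm (S : C0Semigroup P.X) (t : ℝ) : ℝ≥0∞ :=
  posNormNeg P.T (max P.sb P.sd) P.s1 (P.β⁻¹ • S.op t P.B)

namespace OutputFactors

variable {hP : P.IsWellPosed} {R : Z →L[ℝ] P.X} {W : ℝ → P.X →L[ℝ] Z} {k : ℝ → ℝ}
  {c : StrongDual ℝ Z}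

lemma out_op (h : OutputFactors hP S R W k c) {t : ℝ} (ht : 0 < t) (x : P.X) :
    P.out (S.op t x) = c (W t x) := by
  rw [← h.map_apply t ht, h.out_map]

lemma intervalIntegrable_kernel (h : OutputFactors hP S R W k c) {t : ℝ} (ht : 0 ≤ t) :
    IntervalIntegrable k volume 0 t :=
  (intervalIntegrable_iff_integrableOn_Ioc_of_le ht).2 (h.integrable.mono_set Ioc_subset_Ioi_self)

lemma intervalIntegrable_out_conv (h : OutputFactors hP S R W k c) {G : ℝ → P.X} {a t : ℝ}
    (hat : a ≤ t) (hG : ContinuousOn G (Icc a t)) :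
    IntervalIntegrable (fun τ => c (W (t - τ) (G τ))) volume a t := by
  have hint := h.intervalIntegrable_conv h.stable hat
    (h.intervalIntegrable_kernel (sub_nonneg.2 hat)) hG
  exact ⟨c.integrable_comp hint.1, c.integrable_comp hint.2⟩

lemma out_integral (h : OutputFactors hP S R W k c) {G : ℝ → P.X} {t : ℝ}
    (ht : 0 ≤ t) (hG : ContinuousOn G (Icc 0 t)) :
    P.out (∫ τ in (0 : ℝ)..t, S.op (t - τ) (G τ)) = ∫ τ in (0 : ℝ)..t, c (W (t - τ) (G τ)) := by
  have hk := h.intervalIntegrable_kernel (sub_nonneg.2 ht)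
  rw [← h.map_integral_conv h.stable ht hk hG, h.out_map]
  exact (c.intervalIntegral_comp_comm (h.intervalIntegrable_conv h.stable ht hk hG)).symm

lemma enorm_out_le (h : OutputFactors hP S R W k c) {t : ℝ} (ht : 0 < t) (x : P.X) :
    ‖c (W t x)‖ₑ ≤ ‖c‖ₑ * (‖k t‖ₑ * ‖x‖ₑ) := by
  have hW : ‖W t‖ₑ ≤ ‖k t‖ₑ :=
    enorm_le_iff_norm_le.2 ((h.norm_le t ht).trans (le_abs_self _))
  exact (c.le_opENorm _).trans (mul_le_mul_right
    (((W t).le_opENorm x).trans (mul_le_mul_left hW _)) _)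

lemma DH_lt_top (h : OutputFactors hP S R W k c) : P.DH S < ∞ := by
  set Q : Z →L[ℝ] P.X := hP.I0L.comp (inclL P.T (max P.sb P.sd))
  have hbound : P.DH S ≤ ∫⁻ t in Ioi (0 : ℝ), ‖c‖ₑ * (‖k t‖ₑ * ‖Q‖ₑ) := by
    refine setLIntegral_mono' measurableSet_Ioi fun t ht => iSup₂_le fun φ hφ => ?_
    have hφ' : ‖φ‖ₑ ≤ 1 := by
      rw [← ofReal_norm, ← ENNReal.ofReal_one]
      exact ENNReal.ofReal_le_ofReal hφ
    have hQ : ‖Q φ‖ₑ ≤ ‖Q‖ₑ := (Q.le_opENorm φ).trans (mul_le_of_le_one_right' hφ')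
    rw [hP.I0_eq, h.out_op ht]
    exact (h.enorm_out_le ht (Q φ)).trans (by gcongr)
  refine hbound.trans_lt ?_
  rw [lintegral_const_mul' _ _ enorm_ne_top, lintegral_mul_const' _ _ enorm_ne_top]
  exact ENNReal.mul_lt_top enorm_lt_top
    (ENNReal.mul_lt_top h.integrable.hasFiniteIntegral enorm_lt_top)

end OutputFactors

namespace IsWellPosed

lemma K_eq (hP : P.IsWellPosed) (t : ℝ) : P.K S t = -hP.outAinv (S.op t P.B) := by
  rw [K, hP.out_Aβinv, inv_mul_cancel_left₀ hP.β_ne]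

lemma K_zero (hP : P.IsWellPosed) : P.K S 0 = 1 := by
  rw [hP.K_eq, S.op_zero_apply, hP.outAinv_B, neg_neg]

lemma continuousOn_K (hP : P.IsWellPosed) : ContinuousOn (P.K S) (Ici 0) :=
  ((hP.outAinv.continuous.comp_continuousOn (S.continuousOn P.B)).neg).congr fun t _ => hP.K_eq t

lemma tendsto_K (hP : P.IsWellPosed) (hSs : S.ExpStable) : Tendsto (P.K S) atTop (𝓝 0) := by
  have h := ((hP.outAinv.continuous.tendsto 0).comp (hSs.tendsto_op_apply_atTop P.B)).neg
  rw [map_zero, neg_zero] at h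
  exact h.congr fun t => (hP.K_eq t).symm

lemma D_lt_top (hP : P.IsWellPosed) (hSs : S.ExpStable) : P.D S < ∞ := by
  have h : IntegrableOn (P.K S) (Ioi 0) :=
    (hSs.integrableOn_apply hP.outAinv P.B).neg.congr
      (Eventually.of_forall fun t => (hP.K_eq t).symm)
  exact h.hasFiniteIntegral

lemma D_ne_zero (hP : P.IsWellPosed) : P.D S ≠ 0 := by
  intro hD
  have hmeas : AEMeasurable (fun t => ‖P.K S t‖ₑ) (volume.restrict (Ioi 0)) :=
    ((hP.continuousOn_K.mono Ioi_subset_Ici_self).aestronglyMeasurable measurableSet_Ioi).enorm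
  have hae : P.K S =ᵐ[volume.restrict (Ioi 0)] 0 :=
    ((lintegral_eq_zero_iff' hmeas).1 hD).mono fun t ht => enorm_eq_zero.1 ht
  have hzero : EqOn (P.K S) 0 (Ioi 0) := Measure.eqOn_open_of_ae_eq hae isOpen_Ioi
    (hP.continuousOn_K.mono Ioi_subset_Ici_self) continuousOn_const
  have hzero' := hzero.of_subset_closure hP.continuousOn_K continuousOn_const
    Ioi_subset_Ici_self (closure_Ioi (0 : ℝ)).ge
  simpa [hP.K_zero] using hzero' self_mem_Ici

end IsWellPosed

lemma OutputFactors.hasDerivAt_K {hP : P.IsWellPosed} {R : Z →L[ℝ] P.X} {W : ℝ → P.X →L[ℝ] Z}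
    {k : ℝ → ℝ} {c : StrongDual ℝ Z} (h : OutputFactors hP S R W k c) {x : ℝ} (hx : 0 < x) :
    HasDerivAt (P.K S) (-(P.β⁻¹ * c (W x P.B))) x := by
  have hcont : ContinuousOn (fun τ => c (W τ P.B)) (Ioi 0) := c.continuous.comp_continuousOn
    (h.continuousOn_apply h.stable continuousOn_id (fun _ ht => ht) continuousOn_const)
  have hint0 : IntegrableOn (fun τ => c (W τ P.B)) (Ioi 0) :=
    c.integrable_comp (h.integrableOn_apply h.stable h.integrable P.B)
  have hint : IntervalIntegrable (fun τ => c (W τ P.B)) volume 0 x :=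
    (intervalIntegrable_iff_integrableOn_Ioc_of_le hx.le).2 (hint0.mono_set Ioc_subset_Ioi_self)
  have hprim := ((intervalIntegral.integral_hasDerivAt_right hint
    (hcont.stronglyMeasurableAtFilter isOpen_Ioi x hx)
    (hcont.continuousAt (Ioi_mem_nhds hx))).const_mul P.β⁻¹).const_sub 1
  refine hprim.congr_of_eventuallyEq ?_
  filter_upwards [Ioi_mem_nhds hx] with t ht
  rw [h.integral_eq P.B t (le_of_lt ht), hP.K_eq, hP.outAinv_B, inv_mul_cancel_left₀ hP.β_ne]
  ring

end Plant

/-! ### One step of the iteration -/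

lemma le_iSup_mul_enorm {E : Type*} [NormedAddCommGroup E] [NormedSpace ℝ E] {N : E → ℝ≥0∞}
    (hN : ∀ (a : ℝ) x, N (a • x) ≤ ‖a‖ₑ * N x) (x : E) :
    N x ≤ (⨆ (y : E) (_ : ‖y‖ ≤ 1), N y) * ‖x‖ₑ := by
  rcases eq_or_ne x 0 with rfl | hx
  · simpa using hN 0 0
  have hunit : ‖‖x‖⁻¹ • x‖ ≤ 1 := (norm_smul_inv_norm (𝕜 := ℝ) hx).le
  calc N x = N (‖x‖ • (‖x‖⁻¹ • x)) := by rw [smul_inv_smul₀ (norm_ne_zero_iff.2 hx)]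
    _ ≤ ‖x‖ₑ * N (‖x‖⁻¹ • x) := (hN _ _).trans_eq (by rw [enorm_norm])
    _ ≤ ‖x‖ₑ * ⨆ (y : E) (_ : ‖y‖ ≤ 1), N y :=
        mul_le_mul_right (le_iSup₂ (f := fun (y : E) (_ : ‖y‖ ≤ 1) => N y) _ hunit) _
    _ = _ := mul_comm _ _

lemma enorm_le_supNorm {e : ℝ → ℝ} {t τ : ℝ} (hτ : τ ∈ Ioo 0 t) : ‖e τ‖ₑ ≤ supNorm t e :=
  le_iSup₂ (f := fun τ (_ : τ ∈ Ioo 0 t) => ‖e τ‖ₑ) τ hτ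

lemma exists_enorm_le_of_continuousOn {E : Type*} [NormedAddCommGroup E] {g : ℝ → E} {s : Set ℝ}
    (hs : IsCompact s) (hg : ContinuousOn g s) : ∃ C : ℝ≥0∞, C ≠ ∞ ∧ ∀ τ ∈ s, ‖g τ‖ₑ ≤ C := by
  obtain ⟨C, hC⟩ := hs.exists_bound_of_continuousOn hg
  refine ⟨ENNReal.ofReal C, ENNReal.ofReal_ne_top, fun τ hτ => ?_⟩
  rw [← ofReal_norm]
  exact ENNReal.ofReal_le_ofReal (hC τ hτ)

lemma exists_enorm_le_of_limsup_ne_top {E : Type*} [NormedAddCommGroup E] {g : ℝ → E} {a : ℝ}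
    (hg : ContinuousOn g (Ici a)) (hlim : limsup (fun t => ‖g t‖ₑ) atTop ≠ ∞) :
    ∃ C : ℝ≥0∞, C ≠ ∞ ∧ ∀ τ, a ≤ τ → ‖g τ‖ₑ ≤ C := by
  obtain ⟨b, hb⟩ := eventually_atTop.1
    (eventually_lt_of_limsup_lt (ENNReal.lt_add_right hlim one_ne_zero))
  obtain ⟨C, hC, hgC⟩ := exists_enorm_le_of_continuousOn isCompact_Icc
    (hg.mono (Icc_subset_Ici_self : Icc a b ⊆ Ici a))
  refine ⟨max C (limsup (fun t => ‖g t‖ₑ) atTop + 1), ?_, fun τ hτ => ?_⟩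
  · exact (max_lt hC.lt_top (ENNReal.add_lt_top.2 ⟨hlim.lt_top, ENNReal.one_lt_top⟩)).ne
  · rcases le_or_gt τ b with h | h
    · exact le_max_of_le_left (hgC τ ⟨hτ, h⟩)
    · exact le_max_of_le_right (hb τ h.le).le

namespace Plant

variable {Z : Type*} [NormedAddCommGroup Z] [InnerProductSpace ℝ Z] [CompleteSpace Z]
  {P : Plant Z} {S : C0Semigroup P.X}

omit [CompleteSpace Z] in
lemma posNormNeg_eq_imageNorm (T : C0Semigroup Z) (s σ : ℝ) (x : NegSpace T s) :
    posNormNeg T s σ x = imageNorm ((inclL T s).comp (negPow T σ)) x := by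
  refine le_antisymm ?_ ?_
  · refine le_iInf₂ fun v hv => ?_
    exact iInf₂_le_of_le (negPow T σ v) hv (imageNorm_apply_le (negPow T σ) v)
  · refine le_iInf₂ fun φ hφ => le_iInf₂ fun v hv => iInf₂_le_of_le v ?_ le_rfl
    rw [ContinuousLinearMap.comp_apply, hv, inclL_apply, hφ]

lemma IsWellPosed.posNorm_le_posNormNeg (hP : P.IsWellPosed) (φ : Z) :
    posNorm P.T P.s1 φ ≤ posNormNeg P.T (max P.sb P.sd) P.s1 (P.ι φ) := by
  refine le_iInf₂ fun ψ hψ => ?_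
  rw [hP.ι_injective hψ]

lemma ι_smul (a : ℝ) (φ : Z) : P.ι (a • φ) = a • P.ι φ := map_smul (inclL _ _) a φ

lemma ι_zero : P.ι 0 = 0 := map_zero (inclL P.T (max P.sb P.sd))

lemma continuous_ι : Continuous P.ι := (inclL P.T (max P.sb P.sd)).continuous

lemma IsWellPosed.posNormNeg_op_I0_le (hP : P.IsWellPosed) (t : ℝ) (φ : Z) :
    posNormNeg P.T (max P.sb P.sd) P.s1 (S.op t (P.I0 (P.ι φ))) ≤ stateNorm S t * ‖φ‖ₑ := by
  refine le_iSup_mul_enorm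
    (N := fun φ => posNormNeg P.T (max P.sb P.sd) P.s1 (S.op t (P.I0 (P.ι φ)))) (fun a φ => ?_) φ
  rw [posNormNeg_eq_imageNorm, posNormNeg_eq_imageNorm, ι_smul, hP.I0_eq, hP.I0_eq, map_smul,
    map_smul]
  exact imageNorm_smul_le _ _ _

lemma posNormNeg_op_B_le (t a : ℝ) :
    posNormNeg P.T (max P.sb P.sd) P.s1 (S.op t ((P.β⁻¹ * a) • P.B)) ≤ inputNorm S t * ‖a‖ₑ := by
  rw [inputNorm, posNormNeg_eq_imageNorm, posNormNeg_eq_imageNorm, map_smul, mul_comm P.β⁻¹,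
    mul_smul, mul_comm (imageNorm _ _)]
  exact imageNorm_smul_le _ _ _

lemma aemeasurable_inputNorm_sub (hSs : S.ExpStable) (t : ℝ) :
    AEMeasurable (fun τ => inputNorm S (t - τ)) (volume.restrict (Ioo 0 t)) := by
  simp only [inputNorm, posNormNeg_eq_imageNorm]
  borelize P.X
  have hcont : ContinuousOn (fun τ => S.op (t - τ) P.B) (Ioo 0 t) :=
    hSs.continuousOn_op_apply (continuousOn_const.sub continuousOn_id)
      (fun τ hτ => sub_nonneg.2 hτ.2.le) continuousOn_const
  exact (lowerSemicontinuous_imageNorm _).measurable.comp_aemeasurable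
    ((hcont.const_smul P.β⁻¹).aestronglyMeasurable measurableSet_Ioo).aemeasurable

lemma OutputFactors.enorm_out_op_I0_le {hP : P.IsWellPosed} {R : Z →L[ℝ] P.X}
    {W : ℝ → P.X →L[ℝ] Z} {k : ℝ → ℝ} {c : StrongDual ℝ Z} (h : OutputFactors hP S R W k c)
    {t : ℝ} (ht : 0 < t) (φ : Z) :
    ‖c (W t (hP.I0L (P.ι φ)))‖ₑ ≤ outNorm S t * ‖φ‖ₑ := by
  rw [← h.out_op ht, ← hP.I0_eq]
  refine le_iSup_mul_enorm (N := fun φ => ‖P.out (S.op t (P.I0 (P.ι φ)))‖ₑ) (fun a φ => ?_) φ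
  rw [ι_smul, hP.I0_eq, hP.I0_eq, map_smul, h.out_op ht, h.out_op ht, map_smul, map_smul,
    smul_eq_mul, enorm_mul]

lemma IsWellPosed.D_add_mul_top (hP : P.IsWellPosed) (x : ℝ≥0∞) : (P.D S + x) * ∞ = ∞ :=
  ENNReal.mul_top fun h => hP.D_ne_zero (add_eq_zero.1 h).1

lemma DH_mul_eq_DD_mul (J : Set ℝ) (E : ℝ≥0∞) :
    P.DH S * (ENNReal.ofReal P.ε * (P.DB S J * E / (1 - ENNReal.ofReal P.ε * P.DA S J))) =
      P.DD S J * E := by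
  rw [DD, div_eq_mul_inv, div_eq_mul_inv]
  ring

/-- One step of the iteration: the state `y` is driven by the nonlinear increment `F` and by the
previous error `e`. -/
structure IsStep (P : Plant Z) (S : C0Semigroup P.X) (e : ℝ → ℝ) (F y : ℝ → Z) : Prop where
  e_cont : ContinuousOn e (Ici 0)
  F_cont : ContinuousOn F (Ici 0)
  F_le : ∀ t, ‖F t‖ₑ ≤ ENNReal.ofReal P.ε * posNorm P.T P.s1 (y t)
  y_bdd : ∀ t, ∃ C : ℝ≥0∞, C ≠ ∞ ∧ ∀ τ ∈ Icc 0 t, posNorm P.T P.s1 (y τ) ≤ C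
  formula : ∀ t, 0 ≤ t → P.ι (y t) = ∫ τ in (0 : ℝ)..t,
    S.op (t - τ) (P.I0 (P.ι (F τ)) + (P.β⁻¹ * e τ) • P.B)

namespace IsStep

variable {hP : P.IsWellPosed} {R : Z →L[ℝ] P.X} {W : ℝ → P.X →L[ℝ] Z} {k : ℝ → ℝ}
  {c : StrongDual ℝ Z} {e : ℝ → ℝ} {F y : ℝ → Z}

lemma posNorm_le (hs : IsStep P S e F y) (hP : P.IsWellPosed) (hSs : S.ExpStable) {t : ℝ}
    (ht : 0 ≤ t) :
    posNorm P.T P.s1 (y t) ≤ (∫⁻ τ in Ioo 0 t, stateNorm S (t - τ) * ‖F τ‖ₑ) +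
      ∫⁻ τ in Ioo 0 t, inputNorm S (t - τ) * ‖e τ‖ₑ := by
  have hmeas :
      AEMeasurable (fun τ => inputNorm S (t - τ) * ‖e τ‖ₑ) (volume.restrict (Ioo 0 t)) :=
    (aemeasurable_inputNorm_sub hSs t).mul ((hs.e_cont.mono fun τ hτ =>
      hτ.1.le).aestronglyMeasurable measurableSet_Ioo).aemeasurable.enorm
  refine (hP.posNorm_le_posNormNeg _).trans ?_
  rw [hs.formula t ht, intervalIntegral.integral_of_le ht, integral_Ioc_eq_integral_Ioo,
    posNormNeg_eq_imageNorm, ← lintegral_add_right' _ hmeas]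
  refine (imageNorm_integral_le _ _).trans (lintegral_mono fun τ => ?_)
  rw [map_add]
  refine (imageNorm_add_le _ _ _).trans ?_
  rw [← posNormNeg_eq_imageNorm, ← posNormNeg_eq_imageNorm]
  exact add_le_add (hP.posNormNeg_op_I0_le _ _) (posNormNeg_op_B_le _ _)

lemma posNorm_le_of_bound (hs : IsStep P S e F y) (hP : P.IsWellPosed) (hSs : S.ExpStable)
    {t : ℝ} {I : Set ℝ} (hI : Ioo 0 t ⊆ I) (hA : ENNReal.ofReal P.ε * P.DA S I < 1)
    {E : ℝ≥0∞} (hE : E ≠ ∞) (he : ∀ τ ∈ Ioo 0 t, ‖e τ‖ₑ ≤ E) {τ : ℝ} (hτ : τ ∈ Ioo 0 t) :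
    posNorm P.T P.s1 (y τ) ≤ P.DB S I * E / (1 - ENNReal.ofReal P.ε * P.DA S I) := by
  set m : ℝ≥0∞ := ⨆ τ ∈ Ioo 0 t, posNorm P.T P.s1 (y τ)
  have hle : ∀ τ ∈ Ioo 0 t, posNorm P.T P.s1 (y τ) ≤ m := fun τ hτ =>
    le_iSup₂ (f := fun τ (_ : τ ∈ Ioo 0 t) => posNorm P.T P.s1 (y τ)) τ hτ
  have hm : m ≠ ∞ := by
    obtain ⟨C, hC, hyC⟩ := hs.y_bdd t
    exact ne_top_of_le_ne_top hC (iSup₂_le fun τ hτ => hyC τ (Ioo_subset_Icc_self hτ))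
  refine (hle τ hτ).trans (le_div_one_sub_of_le_mul_add hm hA (iSup₂_le fun σ hσ => ?_))
  have hsub : Ioo 0 (σ - 0) ⊆ I := by
    rw [sub_zero]
    exact (Ioo_subset_Ioo_right hσ.2.le).trans hI
  have hF : ∫⁻ τ in Ioo 0 σ, stateNorm S (σ - τ) * ‖F τ‖ₑ ≤
      P.DA S I * (ENNReal.ofReal P.ε * m) :=
    (setLIntegral_Ioo_conv_le (ENNReal.mul_ne_top ENNReal.ofReal_ne_top hm) fun τ hτ =>
      (hs.F_le τ).trans (mul_le_mul_right (hle τ ⟨hτ.1, hτ.2.trans hσ.2⟩) _)).trans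
      (mul_le_mul_left (lintegral_mono_set hsub) _)
  have he' : ∫⁻ τ in Ioo 0 σ, inputNorm S (σ - τ) * ‖e τ‖ₑ ≤ P.DB S I * E :=
    (setLIntegral_Ioo_conv_le hE fun τ hτ => he τ ⟨hτ.1, hτ.2.trans hσ.2⟩).trans
      (mul_le_mul_left (lintegral_mono_set hsub) _)
  calc posNorm P.T P.s1 (y σ) ≤ P.DA S I * (ENNReal.ofReal P.ε * m) + P.DB S I * E :=
        (hs.posNorm_le hP hSs hσ.1.le).trans (add_le_add hF he')
    _ = m * (ENNReal.ofReal P.ε * P.DA S I) + P.DB S I * E := by ring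

lemma out_eq (hs : IsStep P S e F y) (h : OutputFactors hP S R W k c) {t : ℝ} (ht : 0 ≤ t) :
    P.out (P.ι (y t)) = (∫ τ in (0 : ℝ)..t, c (W (t - τ) (hP.I0L (P.ι (F τ))))) +
      ∫ τ in (0 : ℝ)..t, P.β⁻¹ * c (W (t - τ) P.B) * e τ := by
  have hF : ContinuousOn (fun τ => hP.I0L (P.ι (F τ))) (Icc 0 t) :=
    (hP.I0L.continuous.comp continuous_ι).comp_continuousOn (hs.F_cont.mono Icc_subset_Ici_self)
  have he : ContinuousOn (fun τ => (P.β⁻¹ * e τ) • P.B) (Icc 0 t) :=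
    (continuousOn_const.mul (hs.e_cont.mono Icc_subset_Ici_self)).smul continuousOn_const
  rw [hs.formula t ht]
  simp only [hP.I0_eq]
  refine (h.out_integral ht (hF.add he)).trans ?_
  simp only [Pi.add_apply, map_add]
  rw [intervalIntegral.integral_add (h.intervalIntegrable_out_conv ht hF)
    (h.intervalIntegrable_out_conv ht he)]
  congr 1
  refine intervalIntegral.integral_congr fun τ _ => ?_
  simp only [map_smul, smul_eq_mul]
  ring

-- As `K' = -β⁻¹ C e^{A_β t} B` and `K 0 = 1`, integration by parts turns the convolution of
-- `β⁻¹ C e^{A_β t} B` with `e` on `(a, t)` into that of `K` with `e'`.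
lemma error_eq (hs : IsStep P S e F y) (h : OutputFactors hP S R W k c) {a t : ℝ}
    (ha : 0 ≤ a) (hat : a ≤ t) (hd : ∀ τ ∈ Ioo a t, DifferentiableAt ℝ e τ) {C : ℝ≥0∞}
    (hC : C ≠ ∞) (heC : ∀ τ ∈ Ioo a t, ‖deriv e τ‖ₑ ≤ C) :
    e t - P.out (P.ι (y t)) =
      (P.K S (t - a) * e a - ∫ τ in (0 : ℝ)..a, P.β⁻¹ * c (W (t - τ) P.B) * e τ) +
      ((∫ τ in a..t, P.K S (t - τ) * deriv e τ) -
        ∫ τ in (0 : ℝ)..t, c (W (t - τ) (hP.I0L (P.ι (F τ))))) := by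
  have ht : 0 ≤ t := ha.trans hat
  have hderiv : IntervalIntegrable (deriv e) volume a t :=
    intervalIntegrable_deriv_of_bound hat fun τ hτ =>
      toReal_enorm (deriv e τ) ▸ ENNReal.toReal_mono hC (heC τ hτ)
  have hkernel : ∀ x, 0 ≤ x → IntervalIntegrable (fun τ => c (W τ P.B)) volume 0 x := fun x hx => by
    have hint : IntegrableOn (fun τ => c (W τ P.B)) (Ioi 0) :=
      c.integrable_comp (h.integrableOn_apply h.stable h.integrable P.B)
    exact (intervalIntegrable_iff_integrableOn_Ioc_of_le hx).2
      (hint.mono_set Ioc_subset_Ioi_self)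
  have hparts := integral_conv_parts (K' := fun x => -(P.β⁻¹ * c (W x P.B))) hat
    (hP.continuousOn_K.mono Icc_subset_Ici_self) (fun x hx => h.hasDerivAt_K hx.1)
    ((hkernel _ (sub_nonneg.2 hat)).const_mul _).neg
    (hs.e_cont.mono fun τ hτ => ha.trans hτ.1) (fun τ hτ => (hd τ hτ).hasDerivAt) hderiv
  have hint : IntervalIntegrable (fun τ => P.β⁻¹ * c (W (t - τ) P.B) * e τ) volume 0 t :=
    ((h.intervalIntegrable_out_conv ht continuousOn_const).const_mul _).mul_continuousOn
      (hs.e_cont.mono (by rw [uIcc_of_le ht]; exact Icc_subset_Ici_self))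
  have ha' : a ∈ uIcc 0 t := by rw [uIcc_of_le ht]; exact ⟨ha, hat⟩
  have hsplit := intervalIntegral.integral_add_adjacent_intervals
    (hint.mono_set (uIcc_subset_uIcc_left ha')) (hint.mono_set (uIcc_subset_uIcc_right ha'))
  simp only [neg_mul, intervalIntegral.integral_neg] at hparts
  rw [hs.out_eq h ht, hparts, hP.K_zero]
  linarith

lemma enorm_integral_out_le (h : OutputFactors hP S R W k c) {t : ℝ} (ht : 0 ≤ t) :
    ‖∫ τ in (0 : ℝ)..t, c (W (t - τ) (hP.I0L (P.ι (F τ))))‖ₑ ≤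
      ∫⁻ τ in Ioo 0 t, outNorm S (t - τ) * ‖F τ‖ₑ := by
  rw [intervalIntegral.integral_of_le ht, integral_Ioc_eq_integral_Ioo]
  exact (enorm_integral_le_lintegral_enorm _).trans (setLIntegral_mono' measurableSet_Ioo
    fun τ hτ => h.enorm_out_op_I0_le (sub_pos.2 hτ.2) _)

lemma enorm_integral_out_le_of_bound (hs : IsStep P S e F y) (h : OutputFactors hP S R W k c)
    {t : ℝ} (ht : 0 ≤ t) {C : ℝ≥0∞} (hF : ∀ τ ∈ Ioo 0 t, ‖F τ‖ₑ ≤ C) :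
    ‖∫ τ in (0 : ℝ)..t, c (W (t - τ) (hP.I0L (P.ι (F τ))))‖ₑ ≤ P.DH S * C := by
  obtain ⟨M, hM, hFM⟩ := exists_enorm_le_of_continuousOn isCompact_Icc
    (hs.F_cont.mono (Icc_subset_Ici_self : Icc 0 t ⊆ Ici 0))
  refine (enorm_integral_out_le h ht).trans ((setLIntegral_Ioo_conv_le (C := min M C)
    (ne_top_of_le_ne_top hM (min_le_left _ _))
    fun τ hτ => le_min (hFM τ (Ioo_subset_Icc_self hτ)) (hF τ hτ)).trans ?_)
  exact mul_le_mul' (lintegral_mono_set Ioo_subset_Ioi_self) (min_le_right _ _)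

lemma enorm_integral_K_le {u : ℝ → ℝ} {a t : ℝ} (hat : a ≤ t) :
    ‖∫ τ in a..t, P.K S (t - τ) * u τ‖ₑ ≤ ∫⁻ τ in Ioo a t, ‖P.K S (t - τ)‖ₑ * ‖u τ‖ₑ := by
  rw [intervalIntegral.integral_of_le hat, integral_Ioc_eq_integral_Ioo]
  exact (enorm_integral_le_lintegral_enorm _).trans_eq (by simp only [enorm_mul])

end IsStep

end Plant

namespace Plant

variable {Z : Type*} [NormedAddCommGroup Z] [InnerProductSpace ℝ Z] [CompleteSpace Z]
  {P : Plant Z} {S : C0Semigroup P.X}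

namespace IsStep

variable {hP : P.IsWellPosed} {R : Z →L[ℝ] P.X} {W : ℝ → P.X →L[ℝ] Z} {k : ℝ → ℝ}
  {c : StrongDual ℝ Z} {e : ℝ → ℝ} {F y : ℝ → Z}

lemma supNorm_error_le (hs : IsStep P S e F y) (h : OutputFactors hP S R W k c) {t : ℝ}
    (hd : ContDiffOn ℝ 1 e (Ioo 0 t)) (hA : ENNReal.ofReal P.ε * P.DA S (Ioo 0 t) < 1) :
    supNorm t (fun τ => e τ - P.out (P.ι (y τ)) - P.K S τ * e 0) ≤
      (P.D S + P.DD S (Ioo 0 t)) * supNormOne t e := by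
  by_cases htop : supNorm t (deriv e) = ∞
  · rw [supNormOne, htop, max_eq_right le_top, hP.D_add_mul_top]
    exact le_top
  refine iSup₂_le fun τ hτ => ?_
  have hmem : ∀ σ ∈ Ioo 0 τ, σ ∈ Ioo 0 t := fun σ hσ => ⟨hσ.1, hσ.2.trans hτ.2⟩
  have herror : e τ - P.out (P.ι (y τ)) - P.K S τ * e 0 =
      (∫ σ in (0 : ℝ)..τ, P.K S (τ - σ) * deriv e σ) -
        ∫ σ in (0 : ℝ)..τ, c (W (τ - σ) (hP.I0L (P.ι (F σ)))) := by
    rw [hs.error_eq h le_rfl hτ.1.le (fun σ hσ => (hd.differentiableOn one_ne_zero).differentiableAt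
      (Ioo_mem_nhds (hmem σ hσ).1 (hmem σ hσ).2)) htop fun σ hσ => enorm_le_supNorm (hmem σ hσ),
      intervalIntegral.integral_same, sub_zero, sub_zero, add_sub_cancel_left]
  have hK : ‖∫ σ in (0 : ℝ)..τ, P.K S (τ - σ) * deriv e σ‖ₑ ≤ P.D S * supNorm t (deriv e) :=
    (enorm_integral_K_le hτ.1.le).trans <|
      (setLIntegral_Ioo_conv_le (g := fun σ => ‖P.K S σ‖ₑ) htop
        fun σ hσ => enorm_le_supNorm (hmem σ hσ)).trans
      (mul_le_mul_left (lintegral_mono_set Ioo_subset_Ioi_self) _)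
  have hE : supNorm t e ≠ ∞ := by
    obtain ⟨C, hC, heC⟩ := exists_enorm_le_of_continuousOn isCompact_Icc
      (hs.e_cont.mono (Icc_subset_Ici_self : Icc 0 t ⊆ Ici 0))
    exact ne_top_of_le_ne_top hC (iSup₂_le fun σ hσ => heC σ (Ioo_subset_Icc_self hσ))
  have hF : ‖∫ σ in (0 : ℝ)..τ, c (W (τ - σ) (hP.I0L (P.ι (F σ))))‖ₑ ≤
      P.DD S (Ioo 0 t) * supNorm t e := by
    rw [← DH_mul_eq_DD_mul]
    exact hs.enorm_integral_out_le_of_bound h hτ.1.le fun σ hσ => (hs.F_le σ).trans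
      (mul_le_mul_right (hs.posNorm_le_of_bound hP h.stable subset_rfl hA hE
        (fun _ => enorm_le_supNorm) (hmem σ hσ)) _)
  beta_reduce
  rw [herror, add_mul]
  exact enorm_sub_le.trans (add_le_add
    (hK.trans (mul_le_mul_right (le_max_right _ _) _))
    (hF.trans (mul_le_mul_right (le_max_left _ _) _)))

lemma exists_posNorm_le (hs : IsStep P S e F y) (hP : P.IsWellPosed) (hSs : S.ExpStable)
    (hB : P.DB S (Ioi 0) < ∞) (hA : ENNReal.ofReal P.ε * P.DA S (Ioi 0) < 1)
    (he : limsup (fun t => ‖e t‖ₑ) atTop ≠ ∞) :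
    ∃ Y : ℝ≥0∞, Y ≠ ∞ ∧ ∀ τ, 0 < τ → posNorm P.T P.s1 (y τ) ≤ Y := by
  obtain ⟨E, hE, heE⟩ := exists_enorm_le_of_limsup_ne_top hs.e_cont he
  refine ⟨_, ENNReal.div_ne_top (ENNReal.mul_ne_top hB.ne hE) (tsub_pos_of_lt hA).ne',
    fun τ hτ => hs.posNorm_le_of_bound hP hSs (t := τ + 1) Ioo_subset_Ioi_self hA hE
      (fun σ hσ => heE σ hσ.1.le) ⟨hτ, lt_add_one τ⟩⟩

lemma limsup_conv_F_le (hs : IsStep P S e F y) {Y : ℝ≥0∞} (hY : Y ≠ ∞)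
    (hyY : ∀ τ, 0 < τ → posNorm P.T P.s1 (y τ) ≤ Y) {g : ℝ → ℝ≥0∞}
    (hg : ∫⁻ τ in Ioi (0 : ℝ), g τ ≠ ∞) :
    limsup (fun t => ∫⁻ τ in Ioo 0 t, g (t - τ) * ‖F τ‖ₑ) atTop ≤
      (∫⁻ τ in Ioi (0 : ℝ), g τ) *
        (ENNReal.ofReal P.ε * limsup (fun t => posNorm P.T P.s1 (y t)) atTop) := by
  refine (limsup_conv_le hg (ENNReal.mul_ne_top ENNReal.ofReal_ne_top hY) fun τ hτ =>
    (hs.F_le τ).trans (mul_le_mul_right (hyY τ hτ) _)).trans (mul_le_mul_right ?_ _)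
  rw [← ENNReal.limsup_const_mul_of_ne_top ENNReal.ofReal_ne_top]
  exact limsup_le_limsup (Eventually.of_forall hs.F_le)

lemma limsup_posNorm_le (hs : IsStep P S e F y) (hP : P.IsWellPosed) (hSs : S.ExpStable)
    (hB : P.DB S (Ioi 0) < ∞) (hA : ENNReal.ofReal P.ε * P.DA S (Ioi 0) < 1)
    (he : limsup (fun t => ‖e t‖ₑ) atTop ≠ ∞) :
    limsup (fun t => posNorm P.T P.s1 (y t)) atTop ≤
      P.DB S (Ioi 0) * limsup (fun t => ‖e t‖ₑ) atTop /
        (1 - ENNReal.ofReal P.ε * P.DA S (Ioi 0)) := by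
  obtain ⟨Y, hY, hyY⟩ := hs.exists_posNorm_le hP hSs hB hA he
  obtain ⟨E, hE, heE⟩ := exists_enorm_le_of_limsup_ne_top hs.e_cont he
  have hDA : P.DA S (Ioi 0) ≠ ∞ := fun htop => by
    rw [htop, ENNReal.mul_top (ENNReal.ofReal_pos.2 hP.ε_pos).ne'] at hA
    exact not_top_lt hA
  have hm : limsup (fun t => posNorm P.T P.s1 (y t)) atTop ≠ ∞ := ne_top_of_le_ne_top hY
    (limsup_le_of_le (by isBoundedDefault) (eventually_of_mem (Ioi_mem_atTop 0) hyY))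
  refine le_div_one_sub_of_le_mul_add hm hA ?_
  have hstate := limsup_le_limsup (eventually_of_mem (Ici_mem_atTop 0)
    fun t (ht : 0 ≤ t) => hs.posNorm_le hP hSs ht)
  refine hstate.trans ((limsup_add_le_add _ _).trans (add_le_add
    ((hs.limsup_conv_F_le hY hyY hDA).trans_eq ?_)
    (limsup_conv_le hB.ne hE fun τ hτ => heE τ (le_of_lt hτ))))
  change P.DA S (Ioi 0) * (ENNReal.ofReal P.ε * _) = _
  ring

lemma limsup_conv_outNorm_le (hs : IsStep P S e F y) (h : OutputFactors hP S R W k c)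
    (hB : P.DB S (Ioi 0) < ∞) (hA : ENNReal.ofReal P.ε * P.DA S (Ioi 0) < 1)
    (he : limsup (fun t => ‖e t‖ₑ) atTop ≠ ∞) :
    limsup (fun t => ∫⁻ τ in Ioo 0 t, outNorm S (t - τ) * ‖F τ‖ₑ) atTop ≤
      P.DD S (Ioi 0) * limsup (fun t => ‖e t‖ₑ) atTop := by
  obtain ⟨Y, hY, hyY⟩ := hs.exists_posNorm_le hP h.stable hB hA he
  rw [← DH_mul_eq_DD_mul]
  exact (hs.limsup_conv_F_le hY hyY h.DH_lt_top.ne).trans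
    (mul_le_mul_right (mul_le_mul_right (hs.limsup_posNorm_le hP h.stable hB hA he) _) _)

lemma tendsto_transient (hs : IsStep P S e F y) (h : OutputFactors hP S R W k c) (a : ℝ) :
    Tendsto (fun t => ‖P.K S (t - a)‖ₑ * ‖e a‖ₑ +
      ∫⁻ τ in Ioc 0 a, ‖P.β⁻¹ * c (W (t - τ) P.B)‖ₑ * ‖e τ‖ₑ) atTop (𝓝 0) := by
  have hK : Tendsto (fun t => ‖P.K S (t - a)‖ₑ * ‖e a‖ₑ) atTop (𝓝 0) := by
    have hlim := ENNReal.Tendsto.mul_const (b := ‖e a‖ₑ) ((continuous_enorm.tendsto 0).comp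
      ((hP.tendsto_K h.stable).comp (tendsto_atTop_add_const_right atTop (-a) tendsto_id)))
      (Or.inr enorm_ne_top)
    rwa [enorm_zero, zero_mul] at hlim
  have hint : IntegrableOn (fun τ => P.β⁻¹ * c (W τ P.B)) (Ioi 0) :=
    (c.integrable_comp (h.integrableOn_apply h.stable h.integrable P.B)).const_mul _
  obtain ⟨E, hE, heE⟩ := exists_enorm_le_of_continuousOn isCompact_Icc
    (hs.e_cont.mono (Icc_subset_Ici_self : Icc 0 a ⊆ Ici 0))
  simpa only [add_zero] using hK.add (tendsto_setLIntegral_Ioc_conv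
    (g := fun τ => ‖P.β⁻¹ * c (W τ P.B)‖ₑ) hint.hasFiniteIntegral.ne hE
    fun τ hτ => heE τ (Ioc_subset_Icc_self hτ))

lemma enorm_error_le (hs : IsStep P S e F y) (h : OutputFactors hP S R W k c) {a t : ℝ}
    (ha : 0 ≤ a) (hat : a ≤ t) (hd : ∀ τ ∈ Ioo a t, DifferentiableAt ℝ e τ) {C : ℝ≥0∞}
    (hC : C ≠ ∞) (heC : ∀ τ ∈ Ioo a t, ‖deriv e τ‖ₑ ≤ C) :
    ‖e t - P.out (P.ι (y t))‖ₑ ≤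
      (‖P.K S (t - a)‖ₑ * ‖e a‖ₑ +
        ∫⁻ τ in Ioc 0 a, ‖P.β⁻¹ * c (W (t - τ) P.B)‖ₑ * ‖e τ‖ₑ) +
      ((∫⁻ τ in Ioo a t, ‖P.K S (t - τ)‖ₑ * ‖deriv e τ‖ₑ) +
        ∫⁻ τ in Ioo 0 t, outNorm S (t - τ) * ‖F τ‖ₑ) := by
  rw [hs.error_eq h ha hat hd hC heC]
  refine (enorm_add_le _ _).trans (add_le_add (enorm_sub_le.trans (add_le_add ?_ ?_))
    (enorm_sub_le.trans (add_le_add (enorm_integral_K_le hat)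
      (enorm_integral_out_le h (ha.trans hat)))))
  · rw [enorm_mul]
  · rw [intervalIntegral.integral_of_le ha]
    exact (enorm_integral_le_lintegral_enorm _).trans_eq (by simp only [enorm_mul])

lemma limsup_error_le (hs : IsStep P S e F y) (h : OutputFactors hP S R W k c)
    (hd : ContDiffOn ℝ 1 e (Ioi 0)) (hB : P.DB S (Ioi 0) < ∞)
    (hA : ENNReal.ofReal P.ε * P.DA S (Ioi 0) < 1) :
    limsup (fun t => ‖e t - P.out (P.ι (y t))‖ₑ) atTop ≤
      (P.D S + P.DD S (Ioi 0)) * limsup (fun t => max ‖e t‖ₑ ‖deriv e t‖ₑ) atTop := by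
  set L := limsup (fun t => max ‖e t‖ₑ ‖deriv e t‖ₑ) atTop
  by_cases htop : L = ∞
  · rw [htop, hP.D_add_mul_top]
    exact le_top
  have he : limsup (fun t => ‖e t‖ₑ) atTop ≤ L :=
    limsup_le_limsup (Eventually.of_forall fun t => le_max_left _ _)
  have he' : limsup (fun t => ‖deriv e t‖ₑ) atTop ≤ L :=
    limsup_le_limsup (Eventually.of_forall fun t => le_max_right _ _)
  have hC : L + 1 ≠ ∞ := ENNReal.add_ne_top.2 ⟨htop, ENNReal.one_ne_top⟩
  obtain ⟨a, ha, hbound⟩ : ∃ a, 0 < a ∧ ∀ τ, a < τ → ‖deriv e τ‖ₑ ≤ L + 1 := by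
    obtain ⟨b, hb⟩ := eventually_atTop.1
      (eventually_lt_of_limsup_lt (he'.trans_lt (ENNReal.lt_add_right htop one_ne_zero)))
    exact ⟨max b 1, lt_max_of_lt_right one_pos,
      fun τ hτ => (hb τ ((le_max_left _ _).trans hτ.le)).le⟩
  have hev := eventually_of_mem (Ici_mem_atTop a) fun t (ht : a ≤ t) =>
    hs.enorm_error_le h ha.le ht (fun τ hτ => (hd.differentiableOn one_ne_zero).differentiableAt
      (Ioi_mem_nhds (ha.trans hτ.1))) hC fun τ hτ => hbound τ hτ.1
  refine (limsup_le_limsup hev).trans ((limsup_add_le_add _ _).trans ?_)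
  rw [(hs.tendsto_transient h a).limsup_eq, zero_add, add_mul]
  refine (limsup_add_le_add _ _).trans (add_le_add ?_ ?_)
  · exact (limsup_conv_le (g := fun τ => ‖P.K S τ‖ₑ) (hP.D_lt_top h.stable).ne hC hbound).trans
      (mul_le_mul_right he' _)
  · exact (hs.limsup_conv_outNorm_le h hB hA (ne_top_of_le_ne_top htop he)).trans
      (mul_le_mul_right he _)

end IsStep

end Plant

namespace Plant

variable {Z : Type*} [NormedAddCommGroup Z] [InnerProductSpace ℝ Z] [CompleteSpace Z]
  {P : Plant Z} {S : C0Semigroup P.X}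

omit [CompleteSpace Z] in
lemma posNorm_negPow_le (T : C0Semigroup Z) (s : ℝ) (v : Z) :
    posNorm T s (negPow T s v) ≤ ‖v‖ₑ :=
  imageNorm_apply_le (negPow T s) v

namespace IsWellPosed

lemma out_ι_zero (hP : P.IsWellPosed) : P.out (P.ι 0) = 0 := by
  have h := hP.out_ι_negPow 0
  rwa [map_zero, map_zero] at h

lemma continuousOn_out (hP : P.IsWellPosed) {y : ℝ → Z} (hy : ContinuousInto P.T P.sc y) :
    ContinuousOn (fun t => P.out (P.ι (y t))) (Ici 0) := by
  obtain ⟨v, hv, hyv⟩ := hy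
  refine (hP.outBase.continuous.comp_continuousOn hv).congr fun t ht => ?_
  rw [hyv t ht, hP.out_ι_negPow]
  rfl

lemma continuous_f_negPow (hP : P.IsWellPosed) :
    Continuous fun v => P.f (negPow P.T P.s1 v) := by
  refine LipschitzWith.continuous (K := P.ε.toNNReal) fun v w => ?_
  rw [edist_eq_enorm_sub, edist_eq_enorm_sub]
  refine (hP.f_lipschitz _ _).trans ?_
  rw [← map_sub]
  exact mul_le_mul_right (posNorm_negPow_le _ _ _) _

end IsWellPosed

namespace IsIteration

variable {r d : ℝ → ℝ} {z₀ : Z} {n : ℕ} {z : ℕ → ℝ → Z}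

lemma cont_s1 (hz : P.IsIteration S r d z₀ n z) {j : ℕ} (hj : j ≤ n) :
    ContinuousInto P.T P.s1 (z j) := by
  rcases j.eq_zero_or_pos with rfl | h
  exacts [hz.zero.cont_s1, (hz.succ j h hj).cont_s1]

lemma cont_sc (hz : P.IsIteration S r d z₀ n z) {j : ℕ} (hj : j ≤ n) :
    ContinuousInto P.T P.sc (z j) := by
  rcases j.eq_zero_or_pos with rfl | h
  exacts [hz.zero.cont_sc, (hz.succ j h hj).cont_sc]

lemma continuousOn_err (hz : P.IsIteration S r d z₀ n z) (hP : P.IsWellPosed)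
    (hr : ContinuousOn r (Ici 0)) {j : ℕ} (hj : j ≤ n) : ContinuousOn (P.err r z j) (Ici 0) := by
  induction j with
  | zero => exact hr.sub (hP.continuousOn_out (hz.cont_sc hj))
  | succ j ih => exact (ih (by omega)).sub (hP.continuousOn_out (hz.cont_sc hj))

lemma state_zero (hz : P.IsIteration S r d z₀ n z) (hP : P.IsWellPosed) : z 0 0 = z₀ := by
  have h := hz.zero.formula 0 le_rfl
  rw [intervalIntegral.integral_same, add_zero, S.op_zero_apply] at h
  exact hP.ι_injective h

lemma state_succ_zero (hz : P.IsIteration S r d z₀ n z) (hP : P.IsWellPosed) {j : ℕ}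
    (hj : j + 1 ≤ n) : z (j + 1) 0 = 0 := by
  have h := (hz.succ (j + 1) (by omega) hj).formula 0 le_rfl
  rw [intervalIntegral.integral_same, add_zero, S.op_zero_apply] at h
  exact hP.ι_injective h

lemma err_zero (hz : P.IsIteration S r d z₀ n z) (hP : P.IsWellPosed)
    (h0 : P.out (P.ι z₀) = r 0) {j : ℕ} (hj : j ≤ n) : P.err r z j 0 = 0 := by
  induction j with
  | zero => rw [err, hz.state_zero hP, h0, sub_self]
  | succ j ih => rw [err, ih (by omega), hz.state_succ_zero hP hj, hP.out_ι_zero, sub_zero]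

lemma continuousOn_f_partialSum (hz : P.IsIteration S r d z₀ n z) (hP : P.IsWellPosed) {j : ℕ}
    (hj : j ≤ n) : ContinuousOn (fun t => P.f (partialSum z j t)) (Ici 0) := by
  have hrange : ∀ {i}, i ∈ Finset.range (j + 1) → i ≤ n := fun hi =>
    (Nat.lt_succ_iff.1 (Finset.mem_range.1 hi)).trans hj
  have hlift : ∀ i, ∃ v : ℝ → Z, i ≤ n → ContinuousOn v (Ici 0) ∧
      ∀ t : ℝ, 0 ≤ t → z i t = negPow P.T P.s1 (v t) := fun i =>
    if hi : i ≤ n then (hz.cont_s1 hi).imp fun _ hv _ => hv else ⟨0, fun h => absurd h hi⟩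
  choose v hv using hlift
  have hsum : ContinuousOn (fun t => ∑ i ∈ Finset.range (j + 1), v i t) (Ici 0) :=
    continuousOn_finsetSum _ fun i hi => (hv i (hrange hi)).1
  refine (hP.continuous_f_negPow.comp_continuousOn hsum).congr fun t ht => ?_
  simp only [Function.comp, partialSum, map_sum]
  rw [Finset.sum_congr rfl fun i hi => (hv i (hrange hi)).2 t ht]

lemma isStep (hz : P.IsIteration S r d z₀ n z) (hP : P.IsWellPosed)
    (hr : ContinuousOn r (Ici 0)) {j : ℕ} (hj : j + 1 ≤ n) :
    IsStep P S (P.err r z j) (P.Fterm z (j + 1)) (z (j + 1)) where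
  e_cont := hz.continuousOn_err hP hr (by omega)
  F_cont := (hz.continuousOn_f_partialSum hP hj).sub (hz.continuousOn_f_partialSum hP (by omega))
  F_le t := by
    refine (hP.f_lipschitz _ _).trans_eq ?_
    rw [Nat.add_sub_cancel, partialSum, partialSum, Finset.sum_range_succ, add_sub_cancel_left]
  y_bdd t := by
    obtain ⟨v, hv, hyv⟩ := hz.cont_s1 hj
    obtain ⟨C, hC, hvC⟩ := exists_enorm_le_of_continuousOn isCompact_Icc
      (hv.mono (Icc_subset_Ici_self : Icc 0 t ⊆ Ici 0))
    refine ⟨C, hC, fun τ hτ => ?_⟩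
    rw [hyv τ hτ.1]
    exact (posNorm_negPow_le _ _ _).trans (hvC τ hτ)
  formula t ht := by
    have h := (hz.succ (j + 1) (by omega) hj).formula t ht
    rwa [ι_zero, map_zero, zero_add] at h

end IsIteration

end Plant

end GeomReg

end

theorem mainTheorem4_general {Z : Type*} [NormedAddCommGroup Z] [InnerProductSpace ℝ Z]
    [CompleteSpace Z]
    (P : GeomReg.Plant Z) (hP : P.IsWellPosed)
    (S : GeomReg.C0Semigroup P.X) (hS : S.generatorGraph = P.AβGraph) (hSstable : S.ExpStable)
    (r d : ℝ → ℝ) (hr : ContinuousOn r (Ici 0))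
    (z₀ : Z) (n : ℕ) (hn : 1 ≤ n) (z : ℕ → ℝ → Z) (hz : P.IsIteration S r d z₀ n z) :
    (P.D S < ∞ ∧ P.DH S < ∞) ∧
    (∀ t : ℝ, 0 < t → ContDiffOn ℝ 1 (P.err r z (n - 1)) (Ioo 0 t) →
      ENNReal.ofReal P.ε * P.DA S (Ioo 0 t) < 1 →
      (GeomReg.supNorm t (fun τ => P.err r z n τ - P.K S τ * P.err r z (n - 1) 0)
          ≤ (P.D S + P.DD S (Ioo 0 t)) * GeomReg.supNormOne t (P.err r z (n - 1))) ∧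
      (P.out (P.ι z₀) = r 0 →
        GeomReg.supNorm t (P.err r z n)
          ≤ (P.D S + P.DD S (Ioo 0 t)) * GeomReg.supNormOne t (P.err r z (n - 1)))) ∧
    (ContDiffOn ℝ 1 (P.err r z (n - 1)) (Ioi 0) →
      P.DB S (Ioi 0) < ∞ → ENNReal.ofReal P.ε * P.DA S (Ioi 0) < 1 →
      limsup (fun t => ‖P.err r z n t‖ₑ) atTop
        ≤ (P.D S + P.DD S (Ioi 0)) *
          limsup (fun t => max ‖P.err r z (n - 1) t‖ₑ ‖deriv (P.err r z (n - 1)) t‖ₑ) atTop) := by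
  obtain ⟨R, W, k, c, h⟩ := hP.exists_outputFactors hS hSstable
  obtain ⟨m, rfl⟩ : ∃ m, n = m + 1 := ⟨n - 1, by omega⟩
  rw [Nat.add_sub_cancel]
  have hstep := hz.isStep hP hr le_rfl
  refine ⟨⟨hP.D_lt_top hSstable, h.DH_lt_top⟩, fun t _ hC hA => ?_,
    fun hC hB hA => hstep.limsup_error_le h hC hB hA⟩
  have herror := hstep.supNorm_error_le h hC hA
  refine ⟨herror, fun h0 => ?_⟩
  rw [hz.err_zero hP h0 (Nat.le_succ m)] at herror
  simp only [mul_zero, sub_zero] at herror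
  exact herror

theorem mainTheorem4 {Z : Type*} [NormedAddCommGroup Z] [InnerProductSpace ℝ Z] [CompleteSpace Z]
    (P : GeomReg.Plant Z) (hP : P.Assumptions)
    (S : GeomReg.C0Semigroup P.X) (hS : S.generatorGraph = P.AβGraph) (hSstable : S.ExpStable)
    (r d : ℝ → ℝ) (hr : ContinuousOn r (Ici 0)) (hd : ContinuousOn d (Ici 0))
    (z₀ : Z) (n : ℕ) (hn : 1 ≤ n) (z : ℕ → ℝ → Z) (hz : P.IsIteration S r d z₀ n z) :
    (P.D S < ∞ ∧ P.DH S < ∞) ∧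
    (∀ t : ℝ, 0 < t → ContDiffOn ℝ 1 (P.err r z (n - 1)) (Ioo 0 t) →
      ENNReal.ofReal P.ε * P.DA S (Ioo 0 t) < 1 →
      (GeomReg.supNorm t (fun τ => P.err r z n τ - P.K S τ * P.err r z (n - 1) 0)
          ≤ (P.D S + P.DD S (Ioo 0 t)) * GeomReg.supNormOne t (P.err r z (n - 1))) ∧
      (P.out (P.ι z₀) = r 0 →
        GeomReg.supNorm t (P.err r z n)
          ≤ (P.D S + P.DD S (Ioo 0 t)) * GeomReg.supNormOne t (P.err r z (n - 1)))) ∧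
    (ContDiffOn ℝ 1 (P.err r z (n - 1)) (Ioi 0) →
      P.DB S (Ioi 0) < ∞ → ENNReal.ofReal P.ε * P.DA S (Ioi 0) < 1 →
      limsup (fun t => ‖P.err r z n t‖ₑ) atTop
        ≤ (P.D S + P.DD S (Ioi 0)) *
          limsup (fun t => max ‖P.err r z (n - 1) t‖ₑ ‖deriv (P.err r z (n - 1)) t‖ₑ) atTop) :=
  mainTheorem4_general P hP.isWellPosed S hS hSstable r d hr z₀ n hn z hz
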